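/- **Notation.** For $g\in L^1(\mathbb R)$ let $\hat g(s)=\int_{-\infty}^\infty e^{-ist}g(t)\,dt$. For $f\in L^\infty(\mathbb R)$ put $\hat f_1(s)=\int_{-1}^1e^{-ist}f(t)\,dt$ and $\Psi_f(s)=\int_{|t|>1}e^{-ist}f(t)\,\frac{dt}{t^2}$; the Fourier transform of $f$ is the tempered distribution $\hat f=\hat f_1-\Psi_f''$ (second distributional derivative). If $g$ is an indefinite integral of a right continuous function $h$ of bounded variation on $\mathbb R$, the distributional integral of $\Psi_f''$ against $g$ is defined by integration by parts, $$\int_{-\infty}^\infty\Psi_f''\,g=-\int_{-\infty}^\infty\Psi_f'\,h=-\lim_{t\to\infty}\Psi_f(t)h(t)+\lim_{t\to-\infty}\Psi_f(t)h(t)+\int_{-\infty}^\infty\Psi_f(t)\,dh(t)$$ (the last integral being a Stieltjes integral), and, if moreover $\hat f_1g\in L^1(\mathbb R)$, $$\int_{-\infty}^\infty\hat f\,g=\int_{-\infty}^\infty\hat f_1(s)g(s)\,ds-\int_{-\infty}^\infty\Psi_f''\,g .$$ **Theorem.** Let $f\in L^\infty(\mathbb R)$ and $\psi\in L^1(\mathbb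 R)$ be complex-valued, with $\int_{-\infty}^\infty\psi(t)\,dt=1$. Assume that $\hat\psi$ is absolutely continuous, $\hat\psi\in L^1(\mathbb R)$, $\hat\psi'\in L^1(\mathbb R)$, and $\hat\psi'$ is of bounded variation (that is, it agrees almost everywhere with a function of bounded variation on $\mathbb R$). For $a>0$ let $\psi_a(x)=\psi(x/a)/a$, and for $x\in\mathbb R$ let $e_{ix}(s)=e^{ixs}$. Then for all $a>0$ and $x\in\mathbb R$ the distributional integral $$I_a[f](x)=\frac1{2\pi}\int_{-\infty}^\infty e_{ix}\,\widehat{\psi_a}\,\hat f$$ exists, and the following hold. (a) If $f$ is uniformly continuous on $\mathbb R$, then $I_a[f]\to f$ uniformly on $\mathbb R$ as $a\to0^+$; in particular $\lim_{a\to0^+}\|f-I_a[f]\|_\infty=0$. (b) If there are $c>0$ and $\delta>1$ such that $|\psi(x)|\le c(|x|+1)^{-\delta}$ for all $x\in\mathbb R$, then $\lim_{a\to0^+}I_a[f](x)=f(x)$ at each Lebesgue point $x$ of $f$, that is, at each $x$ with $\lim_{r\to0^+}\frac1{2r}\int_{x-r}^{x+r}|f(t)-f(x)|\,dt=0$; in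 particular, for almost all $x$ and at each point $x$ of continuity of $f$. -/

import Mathlib

open Set Filter MeasureTheory Topology
open scoped ENNReal

/-- The Fourier transform `ĝ(s) = ∫ e^{-ist} g(t) dt` of a function `g ∈ L¹(ℝ)`. -/
noncomputable def fourierL1 (g : ℝ → ℂ) (s : ℝ) : ℂ :=
  ∫ t : ℝ, Complex.exp (-(Complex.I * (s : ℂ) * (t : ℂ))) * g t

/-- The Fourier transform `∫_{-1}^{1} e^{-ist} f(t) dt` of `f₁ = f χ_{[-1,1]}`. -/
noncomputable def fourierNear (f : ℝ → ℂ) (s : ℝ) : ℂ :=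
  ∫ t in Icc (-1 : ℝ) 1, Complex.exp (-(Complex.I * (s : ℂ) * (t : ℂ))) * f t

/-- The function `Ψ_f(s) = ∫_{|t|>1} e^{-ist} f(t) dt/t²`. -/
noncomputable def psiFar (f : ℝ → ℂ) (s : ℝ) : ℂ :=
  ∫ t in {t : ℝ | 1 < |t|},
    Complex.exp (-(Complex.I * (s : ℂ) * (t : ℂ))) * f t / (t : ℂ) ^ 2

/-- The Stieltjes integral `∫ F(t) dh(t)` over `ℝ` of a continuous bounded complex function `F`
against a complex function `h` of bounded variation on `ℝ`. -/
noncomputable def stieltjesIntegral (F h : ℝ → ℂ) : ℂ :=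
  open scoped Classical in
  if hh : BoundedVariationOn h univ then
    hh.vectorMeasure.integral F (ContinuousLinearMap.mul ℝ ℂ)
  else 0

/-- The continuous primitive integral `∫ F' h`, where `F'` is the distributional derivative of a
function `F` continuous on the extended real line and `h` is right continuous of bounded variation:
`∫ F' h = lim_{t → ∞} F(t) h(t) - lim_{t → -∞} F(t) h(t) - ∫ F(t) dh(t)`. -/
noncomputable def contPrimitiveIntegral (F h : ℝ → ℂ) : ℂ :=
  limUnder atTop (fun t : ℝ => F t * h t) - limUnder atBot (fun t : ℝ => F t * h t)
    - stieltjesIntegral F h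

/-- The right derivative of `g`. If `g` is an indefinite integral of a right continuous function
`h` of bounded variation, this is `h` at every point. -/
noncomputable def rightDeriv (g : ℝ → ℂ) (x : ℝ) : ℂ := derivWithin g (Ici x) x

/-- The second order distributional integral `∫ F'' g = - ∫ F' h`, where `F''` is the second
distributional derivative of a function `F` continuous on the extended real line and `g` is an
indefinite integral of a right continuous function `h` of bounded variation. -/
noncomputable def secondOrderIntegral (F g : ℝ → ℂ) : ℂ :=
  - contPrimitiveIntegral F (rightDeriv g)

/-- For bounded measurable `f`, the Fourier transform of `f` is the distribution
`f̂ = f̂₁ - Ψ_f''`. This is its distributional integral against `g`,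
`∫ f̂ g = ∫ f̂₁(s) g(s) ds - ∫ Ψ_f'' g`. -/
noncomputable def fourierIntegralAgainst (f g : ℝ → ℂ) : ℂ :=
  (∫ s : ℝ, fourierNear f s * g s) - secondOrderIntegral (psiFar f) g

/-- The distributional integral `∫ f̂ g` exists: `g` is an indefinite integral of a right continuous
function of bounded variation, `f̂₁ g` is Lebesgue integrable, the boundary limits exist and the
Stieltjes integral of `Ψ_f` converges absolutely. -/
structure FourierIntegrableAgainst (f g : ℝ → ℂ) : Prop where
  boundedVariation : BoundedVariationOn (rightDeriv g) univ
  rightContinuous : ∀ x, ContinuousWithinAt (rightDeriv g) (Ici x) x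
  primitive : ∀ x, g x = g 0 + ∫ t in (0 : ℝ)..x, rightDeriv g t
  integrable_near : Integrable (fun s => fourierNear f s * g s)
  lim_atTop : ∃ l, Tendsto (fun t => psiFar f t * rightDeriv g t) atTop (𝓝 l)
  lim_atBot : ∃ l, Tendsto (fun t => psiFar f t * rightDeriv g t) atBot (𝓝 l)
  integrable_far : boundedVariation.vectorMeasure.Integrable (psiFar f)

/-- `ψ_a(x) = ψ(x/a)/a`. -/
noncomputable def dilate (ψ : ℝ → ℂ) (a : ℝ) (x : ℝ) : ℂ := ψ (x / a) / (a : ℂ)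

/-- The function `e_{ix} ψ̂_a`, that is, `s ↦ e^{ixs} ψ̂_a(s)`. -/
noncomputable def inversionKernel (ψ : ℝ → ℂ) (a x : ℝ) (s : ℝ) : ℂ :=
  Complex.exp (Complex.I * (x : ℂ) * (s : ℂ)) * fourierL1 (dilate ψ a) s

/-- `I_a[f](x) = (1/(2π)) ∫ e_{ix} ψ̂_a f̂`. -/
noncomputable def inversionMean (ψ f : ℝ → ℂ) (a x : ℝ) : ℂ :=
  1 / (2 * (Real.pi : ℂ)) * fourierIntegralAgainst f (inversionKernel ψ a x)

/-- `g` is absolutely continuous on every compact interval. -/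
def IsAbsolutelyContinuous (g : ℝ → ℂ) : Prop :=
  ∀ a b : ℝ, AbsolutelyContinuousOnInterval g a b

/-- An almost everywhere defined function is of bounded variation on `ℝ` if it agrees almost
everywhere with a function of bounded variation. -/
def IsAEBoundedVariation (g : ℝ → ℂ) : Prop :=
  ∃ h : ℝ → ℂ, BoundedVariationOn h univ ∧ g =ᵐ[volume] h

/-- `x` is a Lebesgue point of `f`: the averages of `|f - f(x)|` over `[x - r, x + r]` tend to `0`
as `r → 0⁺`. -/
def IsLebesguePoint (f : ℝ → ℂ) (x : ℝ) : Prop :=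
  Tendsto (fun r : ℝ => (2 * r)⁻¹ * ∫ t in Icc (x - r) (x + r), ‖f t - f x‖) (𝓝[>] 0) (𝓝 0)

/-! The distributional integral is an ordinary convolution in disguise: `inversionMean ψ f a x`
equals ∫ f(t) ψ_a(x - t) dt (`inversionMean_eq`). Once this is known, both convergence statements
are facts about approximate identities.

To see the identity, let g be integrable with an integrable right derivative h that is right
continuous and of bounded variation. Fubini turns the near part into the integral of f ĝ over [-1,
1]. In the far part the boundary terms vanish, because Ψ_f tends to 0 at infinity (Riemann–Lebesgue)
and h is bounded. Fubini moves the Fourier transform onto the measure dh, whose transform is it ĥ(t)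
= (it)² ĝ(t) = -t² ĝ(t); this cancels the weight 1/t² and leaves the integral of f ĝ over |t| > 1
(`IsIntegrableBVPrimitive.stieltjesIntegral_eq`, resting on `integral_exp_mul_eq_of_increments`).
For g = e_{ix} ψ̂_a, Fourier inversion gives ĝ(t) = 2π ψ_a(x - t) for almost every t. The class of
such g contains ψ̂ and is stable under dilation and modulation, so it contains every kernel needed.

Since ψ has integral 1, the error is ∫ (f(x - au) - f(x)) ψ(u) du. Uniform continuity makes it small
uniformly in x. At a Lebesgue point, the majorant c(1 + |u|)^{-δ} is a superposition of indicators
of symmetric intervals, on which the means of |f - f(x)| are controlled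
(`tendsto_integral_comp_mul_rpow`). -/

/-! ### Complex measures: finite variation and reduction to densities. -/

section ComplexVectorMeasure

variable {X : Type*} [MeasurableSpace X]

/-- The sum of the total variations of the real and imaginary parts of a complex measure. -/
noncomputable def reImVariation (μ : ComplexMeasure X) : Measure X :=
  (ComplexMeasure.re μ).totalVariation + (ComplexMeasure.im μ).totalVariation

instance (μ : ComplexMeasure X) : IsFiniteMeasure (reImVariation μ) := by
  unfold reImVariation; infer_instance

/-- From |z| ≤ |Re z| + |Im z|. It makes the variation finite, so that bounded measurable functions
are integrable against a complex measure. -/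
theorem variation_le_reImVariation (μ : ComplexMeasure X) : μ.variation ≤ reImVariation μ := by
  refine VectorMeasure.variation_le_of_forall_enorm_le fun s hs => ?_
  have h : ‖μ s‖ₑ ≤ ‖(μ s).re‖ₑ + ‖(μ s).im‖ₑ := by
    rw [← ofReal_norm, ← ofReal_norm, ← ofReal_norm, ← ENNReal.ofReal_add (norm_nonneg _)
      (norm_nonneg _)]
    exact ENNReal.ofReal_le_ofReal (Complex.norm_le_abs_re_add_abs_im _)
  refine h.trans ?_
  rw [reImVariation, Measure.add_apply]
  exact add_le_add ((ComplexMeasure.re μ).enorm_le_totalVariation s)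
    ((ComplexMeasure.im μ).enorm_le_totalVariation s)

instance isFiniteMeasure_variation (μ : ComplexMeasure X) : IsFiniteMeasure μ.variation :=
  isFiniteMeasure_of_le _ (variation_le_reImVariation μ)

/-- Radon–Nikodym. Densities turn Stieltjes integrals into Bochner integrals against a positive
measure, to which Fubini applies. -/
theorem signedMeasure_exists_density (s : SignedMeasure X) (m : Measure X) [SigmaFinite m]
    (h : s.totalVariation ≪ m) :
    ∃ θ : X → ℝ, Integrable θ m ∧ ∀ t, MeasurableSet t → s t = ∫ x in t, θ x ∂m := by
  refine ⟨s.rnDeriv m, SignedMeasure.integrable_rnDeriv _ _, fun t ht => ?_⟩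
  have h' : s ≪ᵥ m.toENNRealVectorMeasure := by
    rw [SignedMeasure.absolutelyContinuous_ennreal_iff]
    rwa [VectorMeasure.ennrealToMeasure_toENNRealVectorMeasure]
  conv_lhs => rw [← SignedMeasure.withDensityᵥ_rnDeriv_eq s m h']
  rw [withDensityᵥ_apply (SignedMeasure.integrable_rnDeriv _ _) ht]

/-- A complex measure has an integrable density with respect to `reImVariation`. -/
theorem complexMeasure_exists_density (μ : ComplexMeasure X) :
    ∃ θ : X → ℂ, Integrable θ (reImVariation μ) ∧
      ∀ t, MeasurableSet t → μ t = ∫ x in t, θ x ∂(reImVariation μ) := by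
  obtain ⟨p, hp, hp'⟩ := signedMeasure_exists_density (ComplexMeasure.re μ) (reImVariation μ)
    (Measure.absolutelyContinuous_of_le (Measure.le_add_right le_rfl))
  obtain ⟨q, hq, hq'⟩ := signedMeasure_exists_density (ComplexMeasure.im μ) (reImVariation μ)
    (Measure.absolutelyContinuous_of_le (Measure.le_add_left le_rfl))
  refine ⟨fun x => (p x : ℂ) + (q x : ℂ) * Complex.I, hp.ofReal.add (hq.ofReal.mul_const _),
    fun t ht => ?_⟩
  have h1 : Integrable (fun x => (p x : ℂ)) ((reImVariation μ).restrict t) := hp.ofReal.restrict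
  have h2 : Integrable (fun x => (q x : ℂ) * Complex.I) ((reImVariation μ).restrict t) :=
    (hq.ofReal.mul_const _).restrict
  rw [integral_add h1 h2, integral_mul_const, integral_complex_ofReal, integral_complex_ofReal,
    ← hp' t ht, ← hq' t ht]
  exact (Complex.re_add_im (μ t)).symm

/-- The integral of a bounded measurable function against a complex measure with density `θ`. -/
theorem complexMeasure_integral_eq_integral_mul {μ : ComplexMeasure X} {m : Measure X}
    {θ : X → ℂ} (hθ : Integrable θ m) (hμ : ∀ t, MeasurableSet t → μ t = ∫ x in t, θ x ∂m)
    {F : X → ℂ} (hF : StronglyMeasurable F) {C : ℝ} (hC : ∀ x, ‖F x‖ ≤ C) :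
    μ.integral F (ContinuousLinearMap.mul ℝ ℂ) = ∫ x, F x * θ x ∂m := by
  have hsimple : ∀ φ : SimpleFunc X ℂ,
      μ.integral φ (ContinuousLinearMap.mul ℝ ℂ) = ∫ x, φ x * θ x ∂m := by
    intro φ
    have hbdd : ∀ ψ : SimpleFunc X ℂ, Integrable (fun x => ψ x * θ x) m := fun ψ => by
      obtain ⟨D, hD⟩ := ψ.exists_forall_norm_le
      exact hθ.bdd_mul ψ.aestronglyMeasurable (.of_forall hD)
    induction φ using SimpleFunc.induction with
    | const c hs =>
      rename_i s
      have h1 : (fun x => (SimpleFunc.piecewise s hs (SimpleFunc.const X c)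
          (SimpleFunc.const X 0)) x) = s.indicator fun _ => c := by
        ext x; simp [SimpleFunc.piecewise, Set.indicator]
      have h2 : ∀ x, s.indicator (fun _ => c) x * θ x = s.indicator (fun x => c * θ x) x := by
        intro x; by_cases hx : x ∈ s <;> simp [hx]
      change μ.integral (fun x => _) _ = _
      rw [h1]
      simp_rw [congrFun h1, h2]
      rw [VectorMeasure.integral_indicator hs, integral_indicator hs,
        VectorMeasure.integral_const, integral_const_mul, ← hμ s hs]
      simp [VectorMeasure.restrict_apply, hs]
    | add hd h1 h2 =>
      rename_i f g
      have hi : ∀ ψ : SimpleFunc X ℂ, μ.Integrable ψ := fun ψ => ψ.integrable_of_isFiniteMeasure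
      rw [SimpleFunc.coe_add]
      change μ.integral (fun x => f x + g x) _ = _
      rw [VectorMeasure.integral_fun_add (hi f) (hi g), h1, h2, ← integral_add (hbdd f) (hbdd g)]
      simp [add_mul]
  -- The bound must be nonnegative for the truncated simple approximations, and C can be negative
  -- when X is empty. Dominated convergence on both sides then extends the formula from simple
  -- functions to F.
  let C' := max C 0
  have hC' : ∀ x, ‖F x‖ ≤ C' := fun x => (hC x).trans (le_max_left _ _)
  let φ : ℕ → SimpleFunc X ℂ := hF.approxBounded C'
  have hφ : ∀ x, Tendsto (fun n => φ n x) atTop (𝓝 (F x)) := fun x =>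
    hF.tendsto_approxBounded_of_norm_le (hC' x)
  have hφC : ∀ n x, ‖φ n x‖ ≤ C' := fun n x =>
    hF.norm_approxBounded_le (le_max_right _ _) n x
  have h1 : Tendsto (fun n => μ.integral (φ n) (ContinuousLinearMap.mul ℝ ℂ)) atTop
      (𝓝 (μ.integral F (ContinuousLinearMap.mul ℝ ℂ))) :=
    VectorMeasure.tendsto_integral_of_dominated_convergence (fun _ => C')
      (fun n => (φ n).aestronglyMeasurable) (integrable_const _)
      (fun n => .of_forall (hφC n)) (.of_forall hφ)
  have h2 : Tendsto (fun n => ∫ x, φ n x * θ x ∂m) atTop (𝓝 (∫ x, F x * θ x ∂m)) := by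
    refine tendsto_integral_of_dominated_convergence (fun x => C' * ‖θ x‖)
      (fun n => (φ n).aestronglyMeasurable.mul hθ.aestronglyMeasurable) (hθ.norm.const_mul _)
      (fun n => .of_forall fun x => ?_) (.of_forall fun x => (hφ x).mul_const _)
    rw [norm_mul]
    exact mul_le_mul_of_nonneg_right (hφC n x) (norm_nonneg _)
  simp_rw [hsimple] at h1
  exact tendsto_nhds_unique h1 h2

end ComplexVectorMeasure

/-! ### Functions of bounded variation on the line. -/

section BoundedVariation

/-- A function whose increments are dominated by a finite measure has bounded variation. -/
theorem boundedVariationOn_of_edist_le_measure {g : ℝ → ℂ} {ρ : Measure ℝ} [IsFiniteMeasure ρ]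
    (h : ∀ x y, x ≤ y → ‖g y - g x‖ₑ ≤ ρ (Ioc x y)) : BoundedVariationOn g univ := by
  refine ne_top_of_le_ne_top (measure_ne_top ρ univ) (iSup_le ?_)
  rintro ⟨n, u, hu, -⟩
  calc ∑ i ∈ Finset.range n, edist (g (u (i + 1))) (g (u i))
      ≤ ∑ i ∈ Finset.range n, ρ (Ioc (u i) (u (i + 1))) :=
        Finset.sum_le_sum fun i _ => by
          rw [edist_eq_enorm_sub]; exact h _ _ (hu (Nat.le_succ i))
    _ = ρ (⋃ i ∈ Finset.range n, Ioc (u i) (u (i + 1))) :=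
        (measure_biUnion_finset (fun i _ j _ hij => hu.pairwise_disjoint_on_Ioc_succ hij)
          fun i _ => measurableSet_Ioc).symm
    _ ≤ ρ univ := measure_mono (subset_univ _)

theorem rightLim_eq_of_continuousWithinAt {h : ℝ → ℂ} {x : ℝ}
    (hc : ContinuousWithinAt h (Ici x) x) : h.rightLim x = h x :=
  rightLim_eq_of_tendsto
    (hc.mono_left (nhdsWithin_mono _ Ioi_subset_Ici_self))

/-- The increments of a right continuous function of bounded variation are given by its measure. -/
theorem BoundedVariationOn.vectorMeasure_Ioc_of_rightContinuous {h : ℝ → ℂ}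
    (hh : BoundedVariationOn h univ) (hc : ∀ x, ContinuousWithinAt h (Ici x) x) {x y : ℝ}
    (hxy : x ≤ y) : hh.vectorMeasure (Ioc x y) = h y - h x := by
  rw [hh.vectorMeasure_Ioc hxy, rightLim_eq_of_continuousWithinAt (hc x),
    rightLim_eq_of_continuousWithinAt (hc y)]

theorem BoundedVariationOn.exists_norm_le {h : ℝ → ℂ} (hh : BoundedVariationOn h univ) :
    ∃ C, 0 ≤ C ∧ ∀ x, ‖h x‖ ≤ C := by
  refine ⟨‖h 0‖ + (eVariationOn h univ).toReal, by positivity, fun x => ?_⟩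
  have h1 := hh.dist_le (mem_univ x) (mem_univ 0)
  rw [dist_eq_norm] at h1
  calc ‖h x‖ = ‖h 0 + (h x - h 0)‖ := by ring_nf
    _ ≤ _ := (norm_add_le _ _).trans (by gcongr)

/-- The finite measure |k(t)| dt dominates the increments. -/
theorem boundedVariationOn_of_integral {g k : ℝ → ℂ} (hk : Integrable k)
    (h : ∀ x y, x ≤ y → g y - g x = ∫ t in Ioc x y, k t) : BoundedVariationOn g univ := by
  have : IsFiniteMeasure (volume.withDensity fun t => ‖k t‖ₑ) :=
    isFiniteMeasure_withDensity hk.2.ne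
  refine boundedVariationOn_of_edist_le_measure
    (ρ := volume.withDensity fun t => ‖k t‖ₑ) fun x y hxy => ?_
  rw [h x y hxy, withDensity_apply _ measurableSet_Ioc]
  exact enorm_integral_le_lintegral_enorm _

/-- The product of a bounded Lipschitz function with an integrable right continuous function of
bounded variation has bounded variation. -/
theorem BoundedVariationOn.lipschitz_mul {F h : ℝ → ℂ} {A L : NNReal}
    (hA : ∀ x, ‖F x‖ₑ ≤ A) (hL : LipschitzWith L F) (hh : BoundedVariationOn h univ)
    (hc : ∀ x, ContinuousWithinAt h (Ici x) x) (hi : Integrable h) :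
    BoundedVariationOn (fun x => F x * h x) univ := by
  have : IsFiniteMeasure (volume.withDensity fun t => ‖h t‖ₑ) :=
    isFiniteMeasure_withDensity hi.2.ne
  let ρ := hh.vectorMeasure.variation
  have hρ : ∀ x y, x ≤ y → ‖h y - h x‖ₑ ≤ ρ (Ioc x y) := fun x y hxy => by
    rw [← hh.vectorMeasure_Ioc_of_rightContinuous hc hxy]
    exact hh.vectorMeasure.enorm_measure_le_variation _
  have hfin : IsFiniteMeasure ρ := isFiniteMeasure_variation _
  refine boundedVariationOn_of_edist_le_measure
    (ρ := (3 * A) • ρ + L • volume.withDensity fun t => ‖h t‖ₑ) fun x y hxy => ?_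
  -- The dangerous term is L(y - x)|h(x)|, a Riemann-sum term for a possibly discontinuous h. Up to
  -- the variation of h on (x, y], |h(x)| is below every value |h(s)| there, hence its product with
  -- the length is below ∫ |h|. The leftover variation is paired with |F(y) - F(x)| ≤ 2A, which with
  -- the A from the other term gives 3A.
  have hsub : ∀ s ∈ Ioc x y, ‖h x‖ₑ - ρ (Ioc x y) ≤ ‖h s‖ₑ := fun s hs => by
    rw [tsub_le_iff_right]
    calc ‖h x‖ₑ = ‖h s - (h s - h x)‖ₑ := by ring_nf
      _ ≤ ‖h s‖ₑ + ‖h s - h x‖ₑ := enorm_sub_le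
      _ ≤ ‖h s‖ₑ + ρ (Ioc x y) := by
        gcongr
        exact (hρ x s hs.1.le).trans (measure_mono (Ioc_subset_Ioc_right hs.2))
  have hint : (‖h x‖ₑ - ρ (Ioc x y)) * volume (Ioc x y) ≤ ∫⁻ t in Ioc x y, ‖h t‖ₑ := by
    rw [← setLIntegral_const]
    exact setLIntegral_mono' measurableSet_Ioc hsub
  have hF1 : ‖F y - F x‖ₑ ≤ L * volume (Ioc x y) := by
    have := hL y x
    rw [edist_eq_enorm_sub] at this
    rwa [Real.volume_Ioc, ← abs_of_nonneg (sub_nonneg.2 hxy), ← Real.dist_eq, ← edist_dist]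
  have hF2 : ‖F y - F x‖ₑ ≤ 2 * A := by
    calc ‖F y - F x‖ₑ ≤ ‖F y‖ₑ + ‖F x‖ₑ := enorm_sub_le
      _ ≤ A + A := add_le_add (hA y) (hA x)
      _ = 2 * A := by ring
  calc ‖F y * h y - F x * h x‖ₑ = ‖F y * (h y - h x) + (F y - F x) * h x‖ₑ := by ring_nf
    _ ≤ ‖F y‖ₑ * ‖h y - h x‖ₑ + ‖F y - F x‖ₑ * ‖h x‖ₑ := by
      refine (enorm_add_le _ _).trans ?_
      rw [enorm_mul, enorm_mul]
    _ ≤ A * ρ (Ioc x y) +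
        ‖F y - F x‖ₑ * ((‖h x‖ₑ - ρ (Ioc x y)) + ρ (Ioc x y)) := by
      gcongr
      · exact hA y
      · exact hρ x y hxy
      · exact le_tsub_add
    _ ≤ A * ρ (Ioc x y) + ((L * volume (Ioc x y)) * (‖h x‖ₑ - ρ (Ioc x y))
        + 2 * A * ρ (Ioc x y)) := by
      rw [mul_add]
      gcongr
    _ ≤ A * ρ (Ioc x y) + (L * (∫⁻ t in Ioc x y, ‖h t‖ₑ) + 2 * A * ρ (Ioc x y)) := by
      rw [mul_assoc, mul_comm (volume _)]
      gcongr
    _ = ((3 * A) • ρ + L • volume.withDensity fun t => ‖h t‖ₑ) (Ioc x y) := by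
      rw [Measure.add_apply, Measure.smul_apply, Measure.smul_apply,
        withDensity_apply _ measurableSet_Ioc, ENNReal.smul_def, ENNReal.smul_def]
      simp only [smul_eq_mul, ENNReal.coe_mul]
      push_cast
      ring

end BoundedVariation

/-! ### Integrable primitives of right continuous functions of bounded variation. -/

section BVPrimitive

theorem BoundedVariationOn.add_fun {g h : ℝ → ℂ} {s : Set ℝ} (hg : BoundedVariationOn g s)
    (hh : BoundedVariationOn h s) : BoundedVariationOn (fun x => g x + h x) s := by
  refine ne_top_of_le_ne_top (ENNReal.add_ne_top.2 ⟨hg, hh⟩) (iSup_le ?_)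
  rintro ⟨n, u, hu, us⟩
  calc ∑ i ∈ Finset.range n, edist (g (u (i + 1)) + h (u (i + 1))) (g (u i) + h (u i))
      ≤ ∑ i ∈ Finset.range n,
          (edist (g (u (i + 1))) (g (u i)) + edist (h (u (i + 1))) (h (u i))) :=
        Finset.sum_le_sum fun i _ => edist_add_add_le _ _ _ _
    _ ≤ _ := by
        rw [Finset.sum_add_distrib]
        exact add_le_add (eVariationOn.sum_le hu us) (eVariationOn.sum_le hu us)

/-- `g` is an integrable indefinite integral of the integrable right continuous function `h` of
bounded variation. -/
structure IsIntegrableBVPrimitive (g h : ℝ → ℂ) : Prop where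
  boundedVariation : BoundedVariationOn h univ
  rightContinuous : ∀ x, ContinuousWithinAt h (Ici x) x
  continuous : Continuous g
  hasDerivWithinAt : ∀ x, HasDerivWithinAt g (h x) (Ici x) x
  integrable : Integrable g
  integrable_deriv : Integrable h

namespace IsIntegrableBVPrimitive

variable {g h : ℝ → ℂ}

/-- The representative h is determined by g at every point, not just almost everywhere, so it is the
one used in the distributional integral. -/
theorem rightDeriv_eq (H : IsIntegrableBVPrimitive g h) : rightDeriv g = h :=
  funext fun x => (H.hasDerivWithinAt x).derivWithin (uniqueDiffOn_Ici x x self_mem_Ici)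

theorem intervalIntegral_eq (H : IsIntegrableBVPrimitive g h) (x y : ℝ) :
    ∫ t in x..y, h t = g y - g x :=
  intervalIntegral.integral_eq_sub_of_hasDeriv_right H.continuous.continuousOn
    (fun t _ => (H.hasDerivWithinAt t).mono Ioi_subset_Ici_self)
    H.integrable_deriv.intervalIntegrable

theorem integral_Ioc_eq (H : IsIntegrableBVPrimitive g h) {x y : ℝ} (hxy : x ≤ y) :
    g y - g x = ∫ t in Ioc x y, h t := by
  rw [← H.intervalIntegral_eq, intervalIntegral.integral_of_le hxy]

theorem comp_mul (H : IsIntegrableBVPrimitive g h) {a : ℝ} (ha : 0 < a) :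
    IsIntegrableBVPrimitive (fun s => g (a * s)) (fun s => a * h (a * s)) where
  boundedVariation := by
    have h1 : BoundedVariationOn (h ∘ fun s => a * s) univ :=
      ne_top_of_le_ne_top H.boundedVariation
        (eVariationOn.comp_le_of_monotoneOn _ _
          (fun _ _ _ _ hxy => mul_le_mul_of_nonneg_left hxy ha.le) (mapsTo_univ _ _))
    exact (lipschitzWith_smul (a : ℂ)).comp_boundedVariationOn h1
  rightContinuous x := by
    refine continuousWithinAt_const.mul ((H.rightContinuous (a * x)).comp
      (f := fun s => a * s) (by fun_prop) fun s hs => ?_)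
    exact mul_le_mul_of_nonneg_left hs ha.le
  continuous := H.continuous.comp (by fun_prop)
  hasDerivWithinAt x := by
    have h1 : HasDerivWithinAt (fun s : ℝ => a * s) a (Ici x) x := by
      simpa using (hasDerivAt_id x).const_mul a |>.hasDerivWithinAt
    have h2 := (H.hasDerivWithinAt (a * x)).scomp x h1
      fun s hs => mul_le_mul_of_nonneg_left hs ha.le
    simpa [Function.comp_def] using h2
  integrable := H.integrable.comp_mul_left' ha.ne'
  integrable_deriv := (H.integrable_deriv.comp_mul_left' ha.ne').const_mul _

/-- Stability under modulation. In the product rule, the term containing g has bounded variation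
because e^{ixs} g(s) has an integrable right derivative; the term containing h is handled by
`BoundedVariationOn.lipschitz_mul`, as e^{ixs} is bounded and Lipschitz. -/
theorem exp_mul (H : IsIntegrableBVPrimitive g h) (x : ℝ) :
    IsIntegrableBVPrimitive (fun s : ℝ => Complex.exp (Complex.I * x * s) * g s)
      (fun s : ℝ => Complex.I * x * (Complex.exp (Complex.I * x * s) * g s)
        + Complex.exp (Complex.I * x * s) * h s) := by
  have hd : ∀ s : ℝ, HasDerivAt (fun s : ℝ => Complex.exp (Complex.I * x * s))
      (Complex.I * x * Complex.exp (Complex.I * x * s)) s := fun s => by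
    have h1 : HasDerivAt (fun s : ℝ => Complex.I * x * (s : ℂ)) (Complex.I * x) s := by
      simpa using (Complex.ofRealCLM.hasDerivAt (x := s)).const_mul (Complex.I * (x : ℂ))
    simpa [mul_comm] using h1.cexp
  have hnorm : ∀ s : ℝ, ‖Complex.exp (Complex.I * x * s)‖ = 1 := fun s : ℝ => by
    rw [show Complex.I * x * s = ((x * s : ℝ) : ℂ) * Complex.I by push_cast; ring,
      Complex.norm_exp_ofReal_mul_I]
  have hcont : Continuous fun s : ℝ => Complex.exp (Complex.I * x * s) := by fun_prop
  have hint : ∀ {u : ℝ → ℂ}, Integrable u →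
      Integrable fun s : ℝ => Complex.exp (Complex.I * x * s) * u s := fun hu =>
    hu.bdd_mul (c := 1) hcont.aestronglyMeasurable (.of_forall fun s : ℝ => (hnorm s).le)
  have hLip : LipschitzWith ‖x‖₊ fun s : ℝ => Complex.exp (Complex.I * x * s) := by
    refine lipschitzWith_of_nnnorm_deriv_le (fun s : ℝ => (hd s).differentiableAt) fun s : ℝ => ?_
    rw [(hd s).deriv, ← NNReal.coe_le_coe]
    simp [hnorm]
  have hderiv : ∀ s : ℝ, HasDerivWithinAt (fun s : ℝ => Complex.exp (Complex.I * x * s) * g s)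
      (Complex.I * x * (Complex.exp (Complex.I * x * s) * g s)
        + Complex.exp (Complex.I * x * s) * h s) (Ici s) s := fun s : ℝ => by
    have := (hd s).hasDerivWithinAt.mul (H.hasDerivWithinAt s)
    simpa [mul_assoc] using! this
  have hk : Integrable (fun s : ℝ => Complex.I * x * (Complex.exp (Complex.I * x * s) * g s)
      + Complex.exp (Complex.I * x * s) * h s) :=
    ((hint H.integrable).const_mul _).add (hint H.integrable_deriv)
  have hgc : Continuous fun s : ℝ => Complex.exp (Complex.I * x * s) * g s :=
    hcont.mul H.continuous
  refine ⟨?_, fun s : ℝ => ?_, hgc, hderiv, hint H.integrable, hk⟩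
  · have h1 : BoundedVariationOn (fun s : ℝ => Complex.exp (Complex.I * x * s) * g s) univ := by
      refine boundedVariationOn_of_integral hk fun u v huv => ?_
      rw [← intervalIntegral.integral_of_le huv]
      exact (intervalIntegral.integral_eq_sub_of_hasDeriv_right hgc.continuousOn
        (fun t _ => (hderiv t).mono Ioi_subset_Ici_self) hk.intervalIntegrable).symm
    have h2 : BoundedVariationOn (fun s : ℝ => Complex.exp (Complex.I * x * s) * h s) univ :=
      BoundedVariationOn.lipschitz_mul (A := 1)
        (fun s : ℝ => by rw [← ofReal_norm, hnorm]; simp)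
        hLip H.boundedVariation H.rightContinuous H.integrable_deriv
    exact ((lipschitzWith_smul (Complex.I * x)).comp_boundedVariationOn h1).add_fun h2
  · exact (continuousWithinAt_const.mul hgc.continuousWithinAt).add
      (hcont.continuousWithinAt.mul (H.rightContinuous s))

end IsIntegrableBVPrimitive

theorem AbsolutelyContinuousOnInterval.comp_lipschitzWith {g : ℝ → ℂ} {φ : ℂ → ℝ} {a b : ℝ}
    (hφ : LipschitzWith 1 φ) (hg : AbsolutelyContinuousOnInterval g a b) :
    AbsolutelyContinuousOnInterval (fun x => φ (g x)) a b := by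
  refine squeeze_zero (fun E => Finset.sum_nonneg fun _ _ => dist_nonneg)
    (fun E => Finset.sum_le_sum fun i _ => ?_) hg
  simpa using hφ.dist_le_mul (g (E.2 i).1) (g (E.2 i).2)

/-- The real and imaginary parts obey the real fundamental theorem of calculus. Almost everywhere
both are differentiable, hence so is g, and there their derivatives are the parts of `deriv g`. -/
theorem IsAbsolutelyContinuous.integral_deriv_eq_sub {g : ℝ → ℂ}
    (hg : IsAbsolutelyContinuous g) (hi : Integrable (deriv g)) (a b : ℝ) :
    ∫ t in a..b, deriv g t = g b - g a := by
  have hre : AbsolutelyContinuousOnInterval (fun x => (g x).re) a b :=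
    (hg a b).comp_lipschitzWith (φ := Complex.re) (LipschitzWith.of_dist_le_mul fun z w => by
      simpa [Complex.dist_eq, Real.dist_eq] using Complex.abs_re_le_norm (z - w))
  have him : AbsolutelyContinuousOnInterval (fun x => (g x).im) a b :=
    (hg a b).comp_lipschitzWith (φ := Complex.im) (LipschitzWith.of_dist_le_mul fun z w => by
      simpa [Complex.dist_eq, Real.dist_eq] using Complex.abs_im_le_norm (z - w))
  have hae : ∀ᵐ t : ℝ, t ∈ uIcc a b → deriv (fun x => (g x).re) t = (deriv g t).re ∧
      deriv (fun x => (g x).im) t = (deriv g t).im := by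
    filter_upwards [hre.ae_differentiableAt, him.ae_differentiableAt] with t h1 h2 ht
    have h3 : DifferentiableAt ℝ g t := by
      have := ((h1 ht).hasDerivAt.ofReal_comp.add
        ((h2 ht).hasDerivAt.ofReal_comp.mul_const Complex.I)).differentiableAt
      refine this.congr_of_eventuallyEq (.of_forall fun x => ?_)
      simp [Complex.re_add_im]
    exact ⟨(Complex.reCLM.hasFDerivAt.comp_hasDerivAt t h3.hasDerivAt).deriv,
      (Complex.imCLM.hasFDerivAt.comp_hasDerivAt t h3.hasDerivAt).deriv⟩
  have h4 := hre.integral_deriv_eq_sub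
  have h5 := him.integral_deriv_eq_sub
  have hii : IntervalIntegrable (deriv g) volume a b := hi.intervalIntegrable
  apply Complex.ext
  · rw [Complex.sub_re, ← h4]
    refine (Complex.reCLM.intervalIntegral_comp_comm hii).symm.trans ?_
    refine intervalIntegral.integral_congr_ae ?_
    filter_upwards [hae] with t ht ht'
    exact (ht (uIoc_subset_uIcc ht')).1.symm
  · rw [Complex.sub_im, ← h5]
    refine (Complex.imCLM.intervalIntegral_comp_comm hii).symm.trans ?_
    refine intervalIntegral.integral_congr_ae ?_
    filter_upwards [hae] with t ht ht'
    exact (ht (uIoc_subset_uIcc ht')).2.symm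

/-- An integrable absolutely continuous function whose derivative is integrable and of bounded
variation is an indefinite integral of a right continuous function of bounded variation. -/
theorem IsAbsolutelyContinuous.exists_isIntegrableBVPrimitive {g : ℝ → ℂ}
    (hg : IsAbsolutelyContinuous g) (hgi : Integrable g) (hi : Integrable (deriv g))
    (hbv : IsAEBoundedVariation (deriv g)) : ∃ h, IsIntegrableBVPrimitive g h := by
  obtain ⟨h₀, h₀bv, h₀ae⟩ := hbv
  have hderiv : ∀ x, HasDerivWithinAt g (h₀.rightLim x) (Ici x) x := fun x => by
    -- Right limits of h₀ are limits of `deriv g` off a null set. The one-sided fundamental theorem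
    -- of calculus needs no more, and gives a right derivative of g at every point.
    have hlim : Tendsto (deriv g) (𝓝[Ioi x] x ⊓ ae volume) (𝓝 (h₀.rightLim x)) :=
      ((h₀bv.tendsto_rightLim x).mono_left inf_le_left).congr'
        ((h₀ae.filter_mono inf_le_right).mono fun _ h => h.symm)
    have h1 : HasDerivWithinAt (fun u => ∫ t in x..u, deriv g t) (h₀.rightLim x) (Ici x) x :=
      intervalIntegral.integral_hasDerivWithinAt_of_tendsto_ae_right
        hi.intervalIntegrable (hi.aestronglyMeasurable.stronglyMeasurableAtFilter) hlim
    have h2 := h1.const_add (g x)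
    refine h2.congr (fun y _ => ?_) ?_ <;> rw [hg.integral_deriv_eq_sub hi] <;> ring
  have hcont : Continuous g := by
    rw [show g = fun x => g 0 + ∫ t in (0 : ℝ)..x, deriv g t from
      funext fun x => by rw [hg.integral_deriv_eq_sub hi]; ring]
    exact continuous_const.add (intervalIntegral.continuous_primitive
      (fun _ _ => hi.intervalIntegrable) 0)
  refine ⟨h₀.rightLim, h₀bv.rightLim, fun x => h₀bv.continuousWithinAt_rightLim, hcont, hderiv,
    hgi, ?_⟩
  refine hi.congr ?_
  have h6 : ∀ᵐ x : ℝ, DifferentiableAt ℝ g x := by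
    have h7 : LocallyBoundedVariationOn g univ := fun a b _ _ =>
      (boundedVariationOn_of_integral hi fun x y hxy => by
        rw [← intervalIntegral.integral_of_le hxy, hg.integral_deriv_eq_sub hi]).mono
        (subset_univ _)
    exact h7.ae_differentiableAt
  filter_upwards [h6] with x hx
  have h8 := hx.hasDerivAt.hasDerivWithinAt (s := Ici x)
  exact (uniqueDiffOn_Ici x x self_mem_Ici).eq_deriv _ h8 (hderiv x)

end BVPrimitive

/-! ### The kernels e_{ix} ψ̂_a belong to the class. -/

section Kernel

theorem fourierL1_dilate (ψ : ℝ → ℂ) {a : ℝ} (ha : 0 < a) (s : ℝ) :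
    fourierL1 (dilate ψ a) s = fourierL1 ψ (a * s) := by
  have h := Measure.integral_comp_div
    (fun t : ℝ => Complex.exp (-(Complex.I * ((a * s : ℝ) : ℂ) * (t : ℂ))) * ψ t) a
  have ha' : (a : ℂ) ≠ 0 := by exact_mod_cast ha.ne'
  rw [abs_of_pos ha, Complex.real_smul] at h
  rw [fourierL1, fourierL1, eq_comm]
  refine mul_left_cancel₀ ha' (h.symm.trans ?_)
  rw [← integral_const_mul]
  refine integral_congr_ae (.of_forall fun t => ?_)
  simp only [dilate]
  push_cast
  rw [show Complex.I * (a * s) * (t / a) = Complex.I * s * t by field_simp]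
  field_simp

theorem isIntegrableBVPrimitive_inversionKernel {ψ : ℝ → ℂ} {h : ℝ → ℂ}
    (H : IsIntegrableBVPrimitive (fourierL1 ψ) h) {a : ℝ} (ha : 0 < a) (x : ℝ) :
    ∃ k, IsIntegrableBVPrimitive (inversionKernel ψ a x) k := by
  have h1 : inversionKernel ψ a x =
      fun s : ℝ => Complex.exp (Complex.I * x * s) * fourierL1 ψ (a * s) :=
    funext fun s => by rw [inversionKernel, fourierL1_dilate ψ ha]
  exact ⟨_, h1 ▸ (H.comp_mul ha).exp_mul x⟩

end Kernel

/-! ### Fubini for Fourier integrals, and the transform of a Stieltjes measure. -/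

section FourierExchange

theorem norm_exp_neg_I_mul (s t : ℝ) : ‖Complex.exp (-(Complex.I * (s : ℂ) * (t : ℂ)))‖ = 1 := by
  rw [show -(Complex.I * (s : ℂ) * (t : ℂ)) = ((-(s * t) : ℝ) : ℂ) * Complex.I by push_cast; ring,
    Complex.norm_exp_ofReal_mul_I]

theorem integrable_exp_mul {ν : Measure ℝ} {w : ℝ → ℂ} (hw : Integrable w ν) (s : ℝ) :
    Integrable (fun t : ℝ => Complex.exp (-(Complex.I * (s : ℂ) * (t : ℂ))) * w t) ν :=
  hw.bdd_mul (c := 1) (Continuous.aestronglyMeasurable (by fun_prop))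
    (.of_forall fun t => (norm_exp_neg_I_mul s t).le)

theorem norm_integral_exp_mul_le {ν : Measure ℝ} {w : ℝ → ℂ} (s : ℝ) :
    ‖∫ t : ℝ, Complex.exp (-(Complex.I * (s : ℂ) * (t : ℂ))) * w t ∂ν‖ ≤ ∫ t, ‖w t‖ ∂ν := by
  refine (norm_integral_le_integral_norm _).trans_eq ?_
  simp_rw [norm_mul, norm_exp_neg_I_mul, one_mul]

theorem continuous_integral_exp_mul {ν : Measure ℝ} {w : ℝ → ℂ} (hw : Integrable w ν) :
    Continuous fun s : ℝ => ∫ t : ℝ, Complex.exp (-(Complex.I * (s : ℂ) * (t : ℂ))) * w t ∂ν := by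
  refine continuous_of_dominated (bound := fun t => ‖w t‖)
    (fun s => (integrable_exp_mul hw s).aestronglyMeasurable)
    (fun s => .of_forall fun t => ?_) hw.norm (.of_forall fun t => by fun_prop)
  rw [norm_mul, norm_exp_neg_I_mul, one_mul]

theorem integral_integral_exp_mul_swap {m ν : Measure ℝ} [SFinite m] [SFinite ν] {w q : ℝ → ℂ}
    (hw : Integrable w ν) (hq : Integrable q m) :
    ∫ s : ℝ, (∫ t : ℝ, Complex.exp (-(Complex.I * (s : ℂ) * (t : ℂ))) * w t ∂ν) * q s ∂m =
      ∫ t : ℝ, w t * (∫ s : ℝ, Complex.exp (-(Complex.I * (t : ℂ) * (s : ℂ))) * q s ∂m) ∂ν := by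
  have hint : Integrable (Function.uncurry fun s t : ℝ =>
      Complex.exp (-(Complex.I * (s : ℂ) * (t : ℂ))) * w t * q s) (m.prod ν) := by
    have h1 : Integrable (fun p : ℝ × ℝ => q p.1 * w p.2) (m.prod ν) := hq.mul_prod hw
    have h2 := h1.bdd_mul (c := 1)
      (f := fun p : ℝ × ℝ => Complex.exp (-(Complex.I * (p.1 : ℂ) * (p.2 : ℂ))))
      (Continuous.aestronglyMeasurable (by fun_prop))
      (.of_forall fun p => (norm_exp_neg_I_mul p.1 p.2).le)
    refine h2.congr (.of_forall fun p => ?_)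
    simp only [Function.uncurry]
    ring
  simp_rw [← integral_mul_const]
  rw [integral_integral_swap hint]
  refine integral_congr_ae (.of_forall fun t => ?_)
  simp only
  rw [← integral_const_mul]
  refine integral_congr_ae (.of_forall fun s => ?_)
  simp only
  rw [show Complex.I * (s : ℂ) * t = Complex.I * t * s by ring]
  ring

/-- If the increments of the integrable function `h` are the integrals of `θ dm`, then the Fourier
transform of `θ dm` is that of `h` multiplied by `it`. -/
theorem integral_exp_mul_eq_of_increments {m : Measure ℝ} [SFinite m] {θ h : ℝ → ℂ}
    (hθ : Integrable θ m) (hh : Integrable h)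
    (hinc : ∀ x y, x ≤ y → h y - h x = ∫ u in Ioc x y, θ u ∂m) {t : ℝ} (ht : t ≠ 0) :
    ∫ s : ℝ, Complex.exp (-(Complex.I * (t : ℂ) * (s : ℂ))) * θ s ∂m =
      Complex.I * t * ∫ s : ℝ, Complex.exp (-(Complex.I * (t : ℂ) * (s : ℂ))) * h s := by
  set E : ℝ → ℂ := fun s => Complex.exp (-(Complex.I * (t : ℂ) * (s : ℂ))) with hE
  have hEc : Continuous E := by simp only [hE]; fun_prop
  have hEn : ∀ s, ‖E s‖ = 1 := norm_exp_neg_I_mul t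
  -- A half-period of E: shifting by ε changes its sign. Pairing E with h(s) - h(s - ε) therefore
  -- doubles ∫ E h, and only increments of h enter, so no integration by parts with boundary terms
  -- is needed.
  let ε : ℝ := Real.pi / |t|
  have hε : 0 < ε := div_pos Real.pi_pos (abs_pos.2 ht)
  have hEε : ∀ s, E (s + ε) = - E s := fun s => by
    have h1 : Complex.exp (-(Complex.I * (t : ℂ) * (ε : ℂ))) = -1 := by
      rcases lt_or_gt_of_ne ht with h | h
      · have h2 : t * ε = -Real.pi := by
          simp only [ε, abs_of_neg h]; field_simp
        rw [show -(Complex.I * (t : ℂ) * (ε : ℂ)) = -((t * ε : ℝ) : ℂ) * Complex.I by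
          push_cast; ring, h2]
        push_cast
        rw [neg_neg, Complex.exp_pi_mul_I]
      · have h2 : t * ε = Real.pi := by
          simp only [ε, abs_of_pos h]; field_simp
        rw [show -(Complex.I * (t : ℂ) * (ε : ℂ)) = -(((t * ε : ℝ) : ℂ) * Complex.I) by
          push_cast; ring, h2, Complex.exp_neg, Complex.exp_pi_mul_I]
        norm_num
    simp only [hE]
    rw [show -(Complex.I * (t : ℂ) * ((s + ε : ℝ) : ℂ)) =
      -(Complex.I * (t : ℂ) * (s : ℂ)) + -(Complex.I * (t : ℂ) * (ε : ℂ)) by push_cast; ring,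
      Complex.exp_add, h1]
    ring
  have hEh : Integrable fun s => E s * h s := integrable_exp_mul hh t
  have hEh' : Integrable fun s => E s * h (s - ε) := integrable_exp_mul (hh.comp_sub_right ε) t
  have hleft : ∫ s, E s * (h s - h (s - ε)) = 2 * ∫ s, E s * h s := by
    simp_rw [mul_sub]
    rw [integral_sub hEh hEh']
    have h3 : ∫ s, E s * h (s - ε) = - ∫ s, E s * h s := by
      rw [← integral_add_right_eq_self (fun s => E s * h (s - ε)) ε, ← integral_neg]
      simp_rw [hEε, add_sub_cancel_right, neg_mul]
    rw [h3]; ring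
  -- The strip s - ε < u ≤ s. Slices at fixed s give the increments of h; slices at fixed u give ∫ E
  -- over a half-period, which is 2E(u)/(it).
  let S : Set (ℝ × ℝ) := {p | p.2 ≤ p.1 ∧ p.1 < p.2 + ε}
  have hS : MeasurableSet S :=
    (measurableSet_le measurable_snd measurable_fst).inter
      (measurableSet_lt measurable_fst (measurable_snd.add_const ε))
  let K : ℝ → ℝ → ℂ := fun s u => S.indicator (fun p => E p.1 * θ p.2) (s, u)
  have hKs : ∀ s u, K s u = (Ioc (s - ε) s).indicator (fun u => E s * θ u) u := fun s u => by
    have : (s, u) ∈ S ↔ u ∈ Ioc (s - ε) s := by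
      simp only [S, mem_ofPred_eq, mem_Ioc, sub_lt_iff_lt_add]; tauto
    by_cases hu : u ∈ Ioc (s - ε) s
    · rw [indicator_of_mem hu]; exact indicator_of_mem (this.2 hu) _
    · rw [indicator_of_notMem hu]; exact indicator_of_notMem (fun h => hu (this.1 h)) _
  have hKu : ∀ s u, K s u = (Ico u (u + ε)).indicator (fun s => E s * θ u) s := fun s u => by
    by_cases hu : s ∈ Ico u (u + ε)
    · rw [indicator_of_mem hu]; exact indicator_of_mem (s := S) (a := (s, u)) hu _
    · rw [indicator_of_notMem hu]; exact indicator_of_notMem (s := S) (a := (s, u)) hu _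
  have hKint : Integrable (Function.uncurry K) (volume.prod m) := by
    have hmeas : AEStronglyMeasurable (Function.uncurry K) (volume.prod m) :=
      ((hEc.comp continuous_fst).aestronglyMeasurable.mul
        hθ.aestronglyMeasurable.comp_snd).indicator hS
    refine (integrable_prod_iff' hmeas).2 ⟨.of_forall fun u => ?_, ?_⟩
    · simp only [Function.uncurry, hKu]
      refine IntegrableOn.integrable_indicator ?_ measurableSet_Ico
      exact ((hEc.mul continuous_const).continuousOn.integrableOn_Icc).mono_set Ico_subset_Icc_self
    · have h4 : ∀ u, ∫ s, ‖Function.uncurry K (s, u)‖ = ε * ‖θ u‖ := fun u => by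
        simp only [Function.uncurry, hKu]
        simp_rw [norm_indicator_eq_indicator_norm, norm_mul, hEn, one_mul]
        rw [integral_indicator measurableSet_Ico, setIntegral_const]
        simp [hε.le]
      simp_rw [h4]
      exact hθ.norm.const_mul ε
  have hright : ∫ s, E s * (h s - h (s - ε)) =
      ∫ u, (2 / (Complex.I * t)) * (E u * θ u) ∂m := by
    calc ∫ s, E s * (h s - h (s - ε)) = ∫ s, ∫ u, K s u ∂m := by
          refine integral_congr_ae (.of_forall fun s => ?_)
          simp only [hKs]
          rw [integral_indicator measurableSet_Ioc, integral_const_mul,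
            hinc (s - ε) s (by linarith)]
      _ = ∫ u, (∫ s, K s u) ∂m := integral_integral_swap hKint
      _ = _ := by
          refine integral_congr_ae (.of_forall fun u => ?_)
          simp only [hKu]
          rw [integral_indicator measurableSet_Ico, integral_mul_const,
            integral_Ico_eq_integral_Ioc, ← intervalIntegral.integral_of_le (by linarith)]
          have hc : -(Complex.I * (t : ℂ)) ≠ 0 :=
            neg_ne_zero.2 (mul_ne_zero Complex.I_ne_zero (by exact_mod_cast ht))
          have h5 : ∫ s in u..(u + ε), E s = (E (u + ε) - E u) / (-(Complex.I * (t : ℂ))) := by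
            have := integral_exp_mul_complex (a := u) (b := u + ε) hc
            simpa only [neg_mul] using this
          rw [h5, hEε, div_neg, ← neg_div]
          ring
  rw [integral_const_mul, hleft] at hright
  have hc : Complex.I * (t : ℂ) ≠ 0 := mul_ne_zero Complex.I_ne_zero (by exact_mod_cast ht)
  have hr : ∫ s, E s * θ s ∂m = Complex.I * t * ∫ s, E s * h s := by
    rw [div_mul_eq_mul_div, eq_div_iff hc] at hright
    linear_combination (-1 / 2) * hright
  exact hr

end FourierExchange

/-! ### Continuity, boundedness and decay of Ψ_f. -/

section FarPart

variable {f : ℝ → ℂ}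

theorem MemLp.exists_ae_norm_le (hf : MemLp f ∞ volume) : ∃ M, 0 ≤ M ∧ ∀ᵐ t, ‖f t‖ ≤ M := by
  refine ⟨(eLpNorm f ∞ volume).toReal, ENNReal.toReal_nonneg, ?_⟩
  filter_upwards [enorm_ae_le_eLpNormEssSup f volume] with t ht
  rw [← toReal_enorm]
  exact ENNReal.toReal_mono hf.2.ne (by rwa [eLpNorm_exponent_top])

theorem measurableSet_one_lt_abs : MeasurableSet {t : ℝ | 1 < |t|} :=
  measurableSet_lt measurable_const measurable_norm

theorem integrableOn_div_sq (hf : MemLp f ∞ volume) :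
    IntegrableOn (fun t : ℝ => f t / (t : ℂ) ^ 2) {t : ℝ | 1 < |t|} := by
  obtain ⟨M, hM, hfM⟩ := MemLp.exists_ae_norm_le hf
  -- For |t| > 1 one has 1/t² ≤ 2/(1 + t²).
  refine Integrable.mono' ((integrable_inv_one_add_sq.const_mul (2 * M)).integrableOn) ?_ ?_
  · exact (hf.aestronglyMeasurable.aemeasurable.div
      (Measurable.aemeasurable (by fun_prop))).aestronglyMeasurable.restrict
  · filter_upwards [ae_restrict_mem measurableSet_one_lt_abs, ae_restrict_of_ae hfM] with t ht hft
    have h1 : 1 < t ^ 2 := by rw [← sq_abs]; exact one_lt_pow₀ ht two_ne_zero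
    rw [norm_div, norm_pow, Complex.norm_real, Real.norm_eq_abs, sq_abs, div_le_iff₀ (by linarith)]
    refine hft.trans ?_
    rw [mul_assoc, mul_comm 2 M, mul_assoc]
    refine le_mul_of_one_le_right hM ?_
    rw [← mul_assoc, mul_comm, ← mul_assoc, le_mul_inv_iff₀ (by linarith)]
    linarith

theorem psiFar_eq (f : ℝ → ℂ) (s : ℝ) : psiFar f s = ∫ t in {t : ℝ | 1 < |t|},
    Complex.exp (-(Complex.I * (s : ℂ) * (t : ℂ))) * (f t / (t : ℂ) ^ 2) := by
  simp_rw [psiFar, mul_div_assoc]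

theorem continuous_psiFar (hf : MemLp f ∞ volume) : Continuous (psiFar f) := by
  simp_rw [funext (psiFar_eq f)]
  exact continuous_integral_exp_mul (integrableOn_div_sq hf)

theorem norm_psiFar_le (f : ℝ → ℂ) (s : ℝ) :
    ‖psiFar f s‖ ≤ ∫ t in {t : ℝ | 1 < |t|}, ‖f t / (t : ℂ) ^ 2‖ := by
  rw [psiFar_eq]
  exact norm_integral_exp_mul_le s

/-- Riemann–Lebesgue, with the frequency rescaled by 2π to match the character e^{-2πist}. -/
theorem tendsto_psiFar_cocompact (f : ℝ → ℂ) : Tendsto (psiFar f) (cocompact ℝ) (𝓝 0) := by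
  have h1 := Real.tendsto_integral_exp_smul_cocompact
    ({t : ℝ | 1 < |t|}.indicator fun t : ℝ => f t / (t : ℂ) ^ 2)
  have hpi : (2 * Real.pi)⁻¹ ≠ 0 := by positivity
  have h2 : Tendsto (fun s : ℝ => (2 * Real.pi)⁻¹ * s) (cocompact ℝ) (cocompact ℝ) :=
    (Homeomorph.mulLeft₀ _ hpi).isClosedEmbedding.tendsto_cocompact
  refine (h1.comp h2).congr fun s => ?_
  rw [psiFar_eq, ← integral_indicator measurableSet_one_lt_abs]
  refine integral_congr_ae (.of_forall fun t => ?_)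
  by_cases ht : t ∈ {t : ℝ | 1 < |t|}
  · simp only [indicator_of_mem ht]
    rw [Circle.smul_def, Real.fourierChar_apply, smul_eq_mul]
    congr 2
    push_cast
    have : (Real.pi : ℂ) ≠ 0 := by exact_mod_cast Real.pi_ne_zero
    field_simp
  · simp only [indicator_of_notMem ht, smul_zero]

theorem MemLp.integrableOn_Icc (hf : MemLp f ∞ volume) (a b : ℝ) : IntegrableOn f (Icc a b) :=
  (hf.restrict (Icc a b)).integrable le_top

end FarPart

/-! ### Existence and value of the distributional integral. -/

section Evaluation

variable {f g h : ℝ → ℂ}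

/-- Both boundary limits are 0, as Ψ_f vanishes at infinity and h is bounded. The Stieltjes integral
converges because Ψ_f is bounded and continuous and the variation of dh is finite. -/
theorem IsIntegrableBVPrimitive.fourierIntegrableAgainst (H : IsIntegrableBVPrimitive g h)
    (hf : MemLp f ∞ volume) : FourierIntegrableAgainst f g := by
  obtain ⟨C, -, hC⟩ := H.boundedVariation.exists_norm_le
  have hlim : ∀ l ≤ cocompact ℝ, Tendsto (fun t => psiFar f t * rightDeriv g t) l (𝓝 0) :=
    fun l hl => by
      rw [H.rightDeriv_eq]
      exact ((tendsto_psiFar_cocompact f).mono_left hl).zero_mul_isBoundedUnder_le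
        (isBoundedUnder_of ⟨C, hC⟩)
  have hbv : BoundedVariationOn (rightDeriv g) univ := H.rightDeriv_eq ▸ H.boundedVariation
  refine ⟨hbv, H.rightDeriv_eq ▸ H.rightContinuous, fun x => ?_, ?_,
    ⟨0, hlim _ atTop_le_cocompact⟩, ⟨0, hlim _ atBot_le_cocompact⟩, ?_⟩
  · rw [H.rightDeriv_eq, H.intervalIntegral_eq]; ring
  · exact H.integrable.bdd_mul
      (continuous_integral_exp_mul (MemLp.integrableOn_Icc hf _ _)).aestronglyMeasurable
      (.of_forall fun s => norm_integral_exp_mul_le s)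
  · exact Integrable.of_bound (continuous_psiFar hf).aestronglyMeasurable _
      (.of_forall (norm_psiFar_le f))

/-- After Fubini, `integral_exp_mul_eq_of_increments` is applied twice, from dh to h and from h to
g. The resulting factor (it)² = -t² cancels the weight in Ψ_f and produces the sign. -/
theorem IsIntegrableBVPrimitive.stieltjesIntegral_eq (H : IsIntegrableBVPrimitive g h)
    (hf : MemLp f ∞ volume) :
    stieltjesIntegral (psiFar f) h = - ∫ t in {t : ℝ | 1 < |t|}, f t * fourierL1 g t := by
  let μ := H.boundedVariation.vectorMeasure
  obtain ⟨θ, hθ, hμ⟩ := complexMeasure_exists_density μ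
  have hinc : ∀ x y, x ≤ y → h y - h x = ∫ u in Ioc x y, θ u ∂(reImVariation μ) :=
    fun x y hxy => by
      rw [← hμ _ measurableSet_Ioc]
      exact (H.boundedVariation.vectorMeasure_Ioc_of_rightContinuous H.rightContinuous hxy).symm
  rw [stieltjesIntegral, dif_pos H.boundedVariation,
    complexMeasure_integral_eq_integral_mul hθ hμ (continuous_psiFar hf).stronglyMeasurable
      (norm_psiFar_le f)]
  simp_rw [psiFar_eq]
  rw [integral_integral_exp_mul_swap (integrableOn_div_sq hf) hθ, ← integral_neg]
  refine setIntegral_congr_fun measurableSet_one_lt_abs fun t ht => ?_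
  have ht0 : t ≠ 0 := fun h0 => by
    rw [mem_ofPred_eq, h0, abs_zero] at ht; linarith
  have ht0' : (t : ℂ) ≠ 0 := by exact_mod_cast ht0
  rw [integral_exp_mul_eq_of_increments hθ H.integrable_deriv hinc ht0,
    integral_exp_mul_eq_of_increments H.integrable_deriv H.integrable
      (fun x y hxy => H.integral_Ioc_eq hxy) ht0, fourierL1]
  field_simp
  rw [Complex.I_sq]
  ring

theorem IsIntegrableBVPrimitive.fourierIntegralAgainst_eq (H : IsIntegrableBVPrimitive g h)
    (hf : MemLp f ∞ volume) : fourierIntegralAgainst f g =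
      (∫ t in Icc (-1 : ℝ) 1, f t * fourierL1 g t)
        + ∫ t in {t : ℝ | 1 < |t|}, f t * fourierL1 g t := by
  obtain ⟨C, -, hC⟩ := H.boundedVariation.exists_norm_le
  have hlim : ∀ l ≤ cocompact ℝ, Tendsto (fun t => psiFar f t * h t) l (𝓝 0) :=
    fun l hl => ((tendsto_psiFar_cocompact f).mono_left hl).zero_mul_isBoundedUnder_le
        (isBoundedUnder_of ⟨C, hC⟩)
  rw [fourierIntegralAgainst, secondOrderIntegral, contPrimitiveIntegral, H.rightDeriv_eq,
    (hlim _ atTop_le_cocompact).limUnder_eq, (hlim _ atBot_le_cocompact).limUnder_eq,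
    H.stieltjesIntegral_eq hf]
  simp_rw [fourierNear]
  rw [integral_integral_exp_mul_swap (MemLp.integrableOn_Icc hf _ _) H.integrable]
  simp [fourierL1]

end Evaluation

/-! ### Fourier inversion and the convolution formula. -/

section Inversion

theorem fourierL1_eq_fourier (u : ℝ → ℂ) (s : ℝ) :
    fourierL1 u s = FourierTransform.fourier u (s / (2 * Real.pi)) := by
  rw [Real.fourier_real_eq_integral_exp_smul, fourierL1]
  refine integral_congr_ae (.of_forall fun t => ?_)
  simp only [smul_eq_mul]
  congr 2
  push_cast
  have : (Real.pi : ℂ) ≠ 0 := by exact_mod_cast Real.pi_ne_zero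
  field_simp

theorem fourierL1_fourierL1_of_continuous {u : ℝ → ℂ} (hc : Continuous u) (hu : Integrable u)
    (hu' : Integrable (fourierL1 u)) (t : ℝ) :
    fourierL1 (fourierL1 u) t = 2 * Real.pi * u (-t) := by
  have hpi : (2 * Real.pi) ≠ 0 := by positivity
  have h1 : Integrable (FourierTransform.fourier u) := by
    have := hu'.comp_mul_left' hpi
    refine this.congr (.of_forall fun s => ?_)
    simp only [fourierL1_eq_fourier]
    field_simp
  have h2 := congrFun (hc.fourierInv_fourier_eq hu h1) (-t)
  rw [← h2, Real.fourierInv_eq_fourier_neg, neg_neg, Real.fourier_real_eq_integral_exp_smul,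
    fourierL1]
  have h3 := Measure.integral_comp_div
    (fun v : ℝ => Complex.exp (((-2 * Real.pi * v * t : ℝ) : ℂ) * Complex.I) •
      FourierTransform.fourier u v) (2 * Real.pi)
  rw [abs_of_pos (by positivity), Complex.real_smul] at h3
  push_cast at h3 ⊢
  rw [← h3]
  refine integral_congr_ae (.of_forall fun s => ?_)
  simp only [smul_eq_mul]
  rw [fourierL1_eq_fourier]
  congr 2
  have : (Real.pi : ℂ) ≠ 0 := by exact_mod_cast Real.pi_ne_zero
  field_simp

theorem integral_fourierL1_mul {w q : ℝ → ℂ} (hw : Integrable w) (hq : Integrable q) :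
    ∫ s, fourierL1 w s * q s = ∫ t, w t * fourierL1 q t :=
  integral_integral_exp_mul_swap hw hq

theorem integrable_fourierL1_of_contDiff {u : ℝ → ℂ} (hu : ContDiff ℝ (⊤ : ℕ∞) u)
    (hc : HasCompactSupport u) : Integrable (fourierL1 u) := by
  have h1 : Integrable (FourierTransform.fourier (hc.toSchwartzMap hu)) := SchwartzMap.integrable _
  have hpi : (2 * Real.pi) ≠ 0 := by positivity
  refine (h1.comp_div hpi).congr (.of_forall fun s => ?_)
  rw [fourierL1_eq_fourier, SchwartzMap.fourier_coe]
  rfl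

/-- The almost everywhere Fourier inversion theorem. -/
theorem fourierL1_fourierL1_ae {w : ℝ → ℂ} (hw : Integrable w) (hw' : Integrable (fourierL1 w)) :
    ∀ᵐ t : ℝ, fourierL1 (fourierL1 w) t = 2 * Real.pi * w (-t) := by
  have hcont : Continuous (fourierL1 (fourierL1 w)) := continuous_integral_exp_mul hw'
  -- Duality: for a test function, two uses of the multiplication formula move the double transform
  -- from w to the test function, where pointwise inversion is available.
  refine ae_eq_of_integral_contDiff_smul_eq hcont.locallyIntegrable
    ((hw.comp_neg.const_mul _).locallyIntegrable) fun v hv hvc => ?_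
  let u : ℝ → ℂ := fun t => (v t : ℂ)
  have hu : ContDiff ℝ (⊤ : ℕ∞) u := Complex.ofRealCLM.contDiff.comp hv
  have huc : HasCompactSupport u := hvc.comp_left Complex.ofReal_zero
  have hui : Integrable u := hu.continuous.integrable_of_hasCompactSupport huc
  have hu' := integrable_fourierL1_of_contDiff hu huc
  calc ∫ t, v t • fourierL1 (fourierL1 w) t
      = ∫ t, fourierL1 (fourierL1 w) t * u t := by
        simp_rw [Complex.real_smul, mul_comm]; rfl
    _ = ∫ t, w t * fourierL1 (fourierL1 u) t := by
        rw [integral_fourierL1_mul hw' hui, integral_fourierL1_mul hw hu']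
    _ = ∫ t, w t * (2 * Real.pi * u (-t)) := by
        simp_rw [fourierL1_fourierL1_of_continuous hu.continuous hui hu']
    _ = ∫ t, w (-t) * (2 * Real.pi * u t) := by
        rw [← integral_neg_eq_self]
        simp_rw [neg_neg]
    _ = ∫ t, v t • (2 * Real.pi * w (-t)) := by
        refine integral_congr_ae (.of_forall fun t => ?_)
        simp only [Complex.real_smul, u]
        ring

theorem integrable_dilate {ψ : ℝ → ℂ} (hψ : Integrable ψ) {a : ℝ} (ha : 0 < a) :
    Integrable (dilate ψ a) :=
  (hψ.comp_div ha.ne').div_const _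

/-- The inversion mean is the convolution of `f` with `ψ_a`. -/
theorem inversionMean_eq {f ψ h : ℝ → ℂ} (hf : MemLp f ∞ volume) (hψ : Integrable ψ)
    (H : IsIntegrableBVPrimitive (fourierL1 ψ) h) {a : ℝ} (ha : 0 < a) (x : ℝ) :
    inversionMean ψ f a x = ∫ t, f t * dilate ψ a (x - t) := by
  obtain ⟨k, hk⟩ := isIntegrableBVPrimitive_inversionKernel H ha x
  have hd := integrable_dilate hψ ha
  have hd' : Integrable (fourierL1 (dilate ψ a)) := by
    simp_rw [funext (fourierL1_dilate ψ ha)]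
    exact H.integrable.comp_mul_left' ha.ne'
  -- The factor e^{ixs} shifts the argument of the double transform of ψ_a to t - x. The identity is
  -- only almost everywhere because ψ need not be continuous.
  have hkernel : ∀ᵐ t : ℝ, fourierL1 (inversionKernel ψ a x) t =
      2 * Real.pi * dilate ψ a (x - t) := by
    have h1 := (measurePreserving_sub_right volume x).quasiMeasurePreserving.ae
      (fourierL1_fourierL1_ae hd hd')
    filter_upwards [h1] with t ht
    rw [neg_sub] at ht
    rw [← ht]
    refine integral_congr_ae (.of_forall fun s => ?_)
    simp only [inversionKernel]
    rw [← mul_assoc, ← Complex.exp_add]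
    congr 2
    push_cast
    ring
  have hint : Integrable fun t => f t * (2 * Real.pi * dilate ψ a (x - t)) := by
    obtain ⟨M, -, hM⟩ := MemLp.exists_ae_norm_le hf
    exact ((hd.comp_sub_left x).const_mul _).bdd_mul hf.aestronglyMeasurable hM
  have hcompl : {t : ℝ | 1 < |t|} = (Icc (-1 : ℝ) 1)ᶜ := by
    ext t
    rw [mem_ofPred_eq, mem_compl_iff, mem_Icc, ← abs_le, not_le]
  have hcongr : ∀ S : Set ℝ, ∫ t in S, f t * fourierL1 (inversionKernel ψ a x) t =
      ∫ t in S, f t * (2 * Real.pi * dilate ψ a (x - t)) := fun S =>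
    integral_congr_ae (by
      filter_upwards [ae_restrict_of_ae hkernel] with t ht
      rw [ht])
  rw [inversionMean, hk.fourierIntegralAgainst_eq hf, hcongr, hcongr, hcompl,
    integral_add_compl measurableSet_Icc hint]
  simp_rw [mul_left_comm (f _)]
  rw [integral_const_mul, ← mul_assoc, one_div, inv_mul_cancel₀, one_mul]
  exact mul_ne_zero two_ne_zero (by exact_mod_cast Real.pi_ne_zero)

/-- Substitute t = x - au in the convolution and subtract f(x) = f(x) ∫ ψ. Both convergence results
use only this formula for the error. -/
theorem inversionMean_sub_eq {f ψ h : ℝ → ℂ} (hf : MemLp f ∞ volume) (hψ : Integrable ψ)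
    (hψ_one : ∫ t, ψ t = 1) (H : IsIntegrableBVPrimitive (fourierL1 ψ) h) {a : ℝ} (ha : 0 < a)
    (x : ℝ) : inversionMean ψ f a x - f x = ∫ u, (f (x - a * u) - f x) * ψ u := by
  have ha' : (a : ℂ) ≠ 0 := by exact_mod_cast ha.ne'
  have hint : Integrable fun u => f (x - a * u) * ψ u := by
    obtain ⟨M, -, hM⟩ := MemLp.exists_ae_norm_le hf
    have hq : Measure.QuasiMeasurePreserving (fun u : ℝ => x - a * u) volume volume :=
      (Measure.measurePreserving_sub_left volume x).quasiMeasurePreserving.comp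
        (Measure.quasiMeasurePreserving_smul volume ha.ne')
    exact hψ.bdd_mul (hf.aestronglyMeasurable.comp_quasiMeasurePreserving hq) (hq.ae hM)
  have h1 : ∫ t, f t * dilate ψ a (x - t) = ∫ u, f (x - a * u) * ψ u := by
    have h2 := integral_sub_left_eq_self (fun t => f t * dilate ψ a (x - t)) volume x
    have h3 := Measure.integral_comp_mul_left (fun t => f (x - t) * ψ (t / a)) a
    rw [← h2]
    simp only [sub_sub_cancel]
    rw [abs_of_pos (inv_pos.2 ha), Complex.real_smul] at h3
    simp only [mul_div_cancel_left₀ _ ha.ne'] at h3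
    rw [h3, ← integral_const_mul]
    refine integral_congr_ae (.of_forall fun t => ?_)
    simp only [dilate]
    push_cast
    field_simp
  rw [inversionMean_eq hf hψ H ha, h1]
  simp_rw [sub_mul]
  rw [integral_sub hint (hψ.const_mul _), integral_const_mul, hψ_one, mul_one]

end Inversion

/-! ### Uniform convergence for uniformly continuous f. -/

section UniformConvergence

/-- The set where the essential bound fails is open and null, hence empty. -/
theorem MemLp.norm_le_of_continuous {f : ℝ → ℂ} (hf : MemLp f ∞ volume) (hc : Continuous f) :
    ∃ M, 0 ≤ M ∧ ∀ t, ‖f t‖ ≤ M := by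
  obtain ⟨M, hM, hfM⟩ := MemLp.exists_ae_norm_le hf
  refine ⟨M, hM, fun t => ?_⟩
  by_contra! ht
  have hopen : IsOpen {t | M < ‖f t‖} := isOpen_lt continuous_const hc.norm
  have h0 : volume {t | M < ‖f t‖} = 0 := by
    simpa [ae_iff] using hfM
  exact (hopen.measure_pos volume ⟨t, ht⟩).ne' h0

/-- Convolution with an integrable kernel converges uniformly for bounded uniformly continuous
functions. -/
theorem tendstoUniformly_of_sub_eq_integral {f ψ : ℝ → ℂ} {I : ℝ → ℝ → ℂ}
    (hf : MemLp f ∞ volume) (hψ : Integrable ψ) (huc : UniformContinuous f)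
    (hI : ∀ a, 0 < a → ∀ x, I a x - f x = ∫ u, (f (x - a * u) - f x) * ψ u) :
    TendstoUniformly I f (𝓝[>] (0 : ℝ)) := by
  obtain ⟨M, hM, hfM⟩ := MemLp.norm_le_of_continuous hf huc.continuous
  rw [Metric.tendstoUniformly_iff]
  intro ε hε
  have hN : 0 ≤ ∫ u, ‖ψ u‖ := integral_nonneg fun _ => norm_nonneg _
  let ε' : ℝ := ε / ((∫ u, ‖ψ u‖) + 1)
  have hε' : 0 < ε' := by positivity
  have hε'lt : ε' * ∫ u, ‖ψ u‖ < ε := by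
    simp only [ε']
    rw [div_mul_eq_mul_div, div_lt_iff₀ (by positivity)]
    nlinarith
  obtain ⟨η, hη, hfη⟩ := Metric.uniformContinuous_iff.1 huc ε' hε'
  -- A majorant of |f(x - au) - f(x)| that does not depend on x. Dominated convergence is applied to
  -- it alone, and this yields uniformity in x.
  let b : ℝ → ℝ → ℝ := fun a u => if |a * u| < η then ε' else 2 * M
  have hb0 : ∀ a u, 0 ≤ b a u := fun a u => by
    simp only [b]; split_ifs <;> positivity
  have hbM : ∀ a u, b a u ≤ ε' + 2 * M := fun a u => by
    simp only [b]; split_ifs <;> linarith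
  have hbm : ∀ a, Measurable (b a) := fun a =>
    Measurable.ite (measurableSet_lt (by fun_prop) measurable_const) measurable_const
      measurable_const
  have hbmeas : ∀ a, AEStronglyMeasurable (fun u => b a u * ‖ψ u‖) volume := fun a =>
    (hbm a).aestronglyMeasurable.mul hψ.norm.aestronglyMeasurable
  have hbn : ∀ a u, ‖b a u * ‖ψ u‖‖ ≤ (ε' + 2 * M) * ‖ψ u‖ := fun a u => by
    rw [Real.norm_of_nonneg (mul_nonneg (hb0 a u) (norm_nonneg _))]
    exact mul_le_mul_of_nonneg_right (hbM a u) (norm_nonneg _)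
  have hlim : Tendsto (fun a => ∫ u, b a u * ‖ψ u‖) (𝓝[>] 0) (𝓝 (∫ u, ε' * ‖ψ u‖)) := by
    refine tendsto_integral_filter_of_dominated_convergence (fun u => (ε' + 2 * M) * ‖ψ u‖)
      (.of_forall hbmeas) (.of_forall fun a => .of_forall (hbn a)) (hψ.norm.const_mul _)
      (.of_forall fun u => ?_)
    refine tendsto_const_nhds.congr' ?_
    have h1 : Tendsto (fun a : ℝ => |a * u|) (𝓝[>] 0) (𝓝 0) := by
      have : Continuous fun a : ℝ => |a * u| := by fun_prop
      simpa using this.tendsto' 0 0 (by simp) |>.mono_left (nhdsWithin_le_nhds (s := Ioi 0))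
    filter_upwards [h1.eventually_lt_const hη] with a ha
    simp only [b, if_pos ha]
  rw [integral_const_mul] at hlim
  filter_upwards [hlim.eventually_lt_const hε'lt, self_mem_nhdsWithin] with a ha ha0 x
  rw [dist_comm, dist_eq_norm, hI a ha0 x]
  refine lt_of_le_of_lt (norm_integral_le_of_norm_le
    ((hψ.norm.const_mul _).mono' (hbmeas a) (.of_forall (hbn a)))
    (.of_forall fun u => ?_)) ha
  rw [norm_mul]
  refine mul_le_mul_of_nonneg_right ?_ (norm_nonneg _)
  simp only [b]
  split_ifs with hu
  · rw [← dist_eq_norm]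
    refine (hfη ?_).le
    rwa [Real.dist_eq, sub_sub_cancel_left, abs_neg]
  · calc ‖f (x - a * u) - f x‖ ≤ ‖f (x - a * u)‖ + ‖f x‖ := norm_sub_le _ _
      _ ≤ 2 * M := by linarith [hfM (x - a * u), hfM x]

theorem tendsto_eLpNorm_top_of_tendstoUniformly {f : ℝ → ℂ} {I : ℝ → ℝ → ℂ} {l : Filter ℝ}
    (h : TendstoUniformly I f l) :
    Tendsto (fun a => eLpNorm (fun x => f x - I a x) ∞ volume) l (𝓝 0) := by
  rw [ENNReal.tendsto_nhds_zero]
  intro ε hε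
  -- Since ε may be infinite, a finite positive r below it serves as the uniform tolerance.
  obtain ⟨r, hr0, hr⟩ := ENNReal.lt_iff_exists_nnreal_btwn.1 hε
  have hr0' : (0 : ℝ) < r := by exact_mod_cast hr0
  filter_upwards [Metric.tendstoUniformly_iff.1 h r hr0'] with a ha
  rw [eLpNorm_exponent_top]
  refine (eLpNormEssSup_le_of_ae_enorm_bound (.of_forall fun x => ?_)).trans hr.le
  have := ha x
  rw [dist_eq_norm] at this
  rw [enorm_eq_nnnorm]
  exact_mod_cast this.le

end UniformConvergence

/-! ### Pointwise convergence at Lebesgue points. -/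

section LebesguePoints

variable {δ : ℝ}

theorem hasDerivAt_neg_one_add_rpow {r : ℝ} (hr : 0 ≤ r) :
    HasDerivAt (fun r : ℝ => -(1 + r) ^ (-δ)) (δ * (1 + r) ^ (-δ - 1)) r := by
  have h1 : HasDerivAt (fun r : ℝ => 1 + r) 1 r := (hasDerivAt_id r).const_add 1
  have h2 := (h1.rpow_const (p := -δ) (Or.inl (by positivity))).neg
  simpa using! h2

theorem tendsto_neg_one_add_rpow (hδ : 0 < δ) :
    Tendsto (fun r : ℝ => -(1 + r) ^ (-δ)) atTop (𝓝 0) := by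
  have := ((tendsto_rpow_neg_atTop hδ).comp (tendsto_atTop_add_const_left atTop 1 tendsto_id)).neg
  simpa using this

theorem integrableOn_rpow_layer (hδ : 0 < δ) {s : ℝ} (hs : 0 ≤ s) :
    IntegrableOn (fun r : ℝ => δ * (1 + r) ^ (-δ - 1)) (Ioi s) :=
  integrableOn_Ioi_deriv_of_nonneg'
    (fun r hr => hasDerivAt_neg_one_add_rpow (hs.trans hr))
    (fun r hr => by have : 0 ≤ r := hs.trans (le_of_lt hr); positivity)
    (tendsto_neg_one_add_rpow hδ)

theorem integral_rpow_layer (hδ : 0 < δ) {s : ℝ} (hs : 0 ≤ s) :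
    ∫ r in Ioi s, δ * (1 + r) ^ (-δ - 1) = (1 + s) ^ (-δ) := by
  rw [integral_Ioi_of_hasDerivAt_of_nonneg'
    (fun r hr => hasDerivAt_neg_one_add_rpow (hs.trans hr))
    (fun r hr => by have : 0 ≤ r := hs.trans (le_of_lt hr); positivity)
    (tendsto_neg_one_add_rpow hδ)]
  ring

/-- The layer cake formula for the kernel `(1 + |u|)^{-δ}`. -/
theorem integral_mul_rpow_eq (hδ : 1 < δ) {φ : ℝ → ℝ} {M : ℝ}
    (hφ : AEStronglyMeasurable φ volume) (hM : ∀ᵐ u, ‖φ u‖ ≤ M) :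
    Integrable (fun r => δ * (1 + r) ^ (-δ - 1) * ∫ u in Ioo (-r) r, φ u)
      (volume.restrict (Ioi 0)) ∧
    ∫ u, φ u * (1 + |u|) ^ (-δ) =
      ∫ r in Ioi 0, δ * (1 + r) ^ (-δ - 1) * ∫ u in Ioo (-r) r, φ u := by
  have hδ0 : 0 < δ := by linarith
  -- The weight (1 + |u|)^{-δ} is the integral of δ(1 + r)^{-δ-1} over r > |u|; Fubini on this cone
  -- exchanges it for integrals of φ over (-r, r).
  let S : Set (ℝ × ℝ) := {p | |p.1| < p.2}
  have hS : MeasurableSet S := measurableSet_lt (by fun_prop) measurable_snd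
  let K : ℝ → ℝ → ℝ := fun u r => S.indicator (fun p => δ * (1 + p.2) ^ (-δ - 1) * φ p.1) (u, r)
  have hKu : ∀ u r, K u r = (Ioi |u|).indicator (fun r => δ * (1 + r) ^ (-δ - 1) * φ u) r :=
    fun u r => by
      by_cases h : |u| < r
      · rw [indicator_of_mem (s := Ioi |u|) h]; exact indicator_of_mem (s := S) (a := (u, r)) h _
      · rw [indicator_of_notMem (s := Ioi |u|) h]
        exact indicator_of_notMem (s := S) (a := (u, r)) h _
  have hKr : ∀ u r, K u r = (Ioo (-r) r).indicator (fun u => δ * (1 + r) ^ (-δ - 1) * φ u) u :=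
    fun u r => by
      by_cases h : |u| < r
      · rw [indicator_of_mem (s := Ioo (-r) r) (abs_lt.1 h)]
        exact indicator_of_mem (s := S) (a := (u, r)) h _
      · rw [indicator_of_notMem (s := Ioo (-r) r) (fun h' => h (abs_lt.2 h'))]
        exact indicator_of_notMem (s := S) (a := (u, r)) h _
  have hinter : ∀ u : ℝ, Ioi |u| ∩ Ioi 0 = Ioi |u| := fun u =>
    inter_eq_left.2 (Ioi_subset_Ioi (abs_nonneg u))
  have hKuint : ∀ u (F : ℝ → ℝ), ∫ r in Ioi 0, (Ioi |u|).indicator F r = ∫ r in Ioi |u|, F r :=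
    fun u F => by
      rw [integral_indicator measurableSet_Ioi, Measure.restrict_restrict measurableSet_Ioi,
        hinter]
  have hKint : Integrable (Function.uncurry K) (volume.prod (volume.restrict (Ioi 0))) := by
    have hmeas : AEStronglyMeasurable (Function.uncurry K)
        (volume.prod (volume.restrict (Ioi 0))) := by
      refine AEStronglyMeasurable.indicator ?_ hS
      refine AEStronglyMeasurable.mul ?_ hφ.comp_fst
      exact Measurable.aestronglyMeasurable (by fun_prop)
    refine (integrable_prod_iff hmeas).2 ⟨.of_forall fun u => ?_, ?_⟩
    · simp only [Function.uncurry, hKu]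
      refine IntegrableOn.integrable_indicator ?_ measurableSet_Ioi
      rw [IntegrableOn, Measure.restrict_restrict measurableSet_Ioi, hinter]
      exact (integrableOn_rpow_layer hδ0 (abs_nonneg u)).mul_const _
    · have h4 : ∀ u, ∫ r in Ioi 0, ‖Function.uncurry K (u, r)‖ = ‖φ u‖ * (1 + ‖u‖) ^ (-δ) :=
        fun u => by
          simp only [Function.uncurry, hKu]
          simp_rw [norm_indicator_eq_indicator_norm, norm_mul]
          rw [hKuint, integral_mul_const, mul_comm, Real.norm_eq_abs u,
            ← integral_rpow_layer hδ0 (abs_nonneg u)]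
          congr 1
          refine setIntegral_congr_fun measurableSet_Ioi fun r hr => ?_
          have : 0 ≤ r := (abs_nonneg u).trans (le_of_lt hr)
          rw [← norm_mul, Real.norm_of_nonneg (by positivity)]
      simp_rw [h4]
      exact (integrable_one_add_norm (by simpa using hδ)).bdd_mul hφ.norm
        (hM.mono fun u hu => by rwa [norm_norm])
  have hKri : ∀ r, ∫ u, K u r = δ * (1 + r) ^ (-δ - 1) * ∫ u in Ioo (-r) r, φ u := fun r => by
    simp only [hKr]
    rw [integral_indicator measurableSet_Ioo, integral_const_mul]
  refine ⟨?_, ?_⟩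
  · refine hKint.integral_prod_right.congr (.of_forall fun r => ?_)
    exact hKri r
  · calc ∫ u, φ u * (1 + |u|) ^ (-δ) = ∫ u, ∫ r in Ioi 0, K u r := by
          refine integral_congr_ae (.of_forall fun u => ?_)
          simp only [hKu]
          rw [hKuint, integral_mul_const, integral_rpow_layer hδ0 (abs_nonneg u), mul_comm]
      _ = ∫ r in Ioi 0, ∫ u, K u r := integral_integral_swap hKint
      _ = _ := by simp_rw [hKri]

/-- If the means of the bounded function `φ` over `[-ρ, ρ]` tend to zero, then so do its means
weighted by the dilations of `(1 + |u|)^{-δ}`. -/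
theorem tendsto_integral_comp_mul_rpow (hδ : 1 < δ) {φ : ℝ → ℝ} {M : ℝ}
    (hφ : AEStronglyMeasurable φ volume) (hM : ∀ᵐ u, ‖φ u‖ ≤ M)
    (hmean : Tendsto (fun ρ : ℝ => (2 * ρ)⁻¹ * ∫ t in Icc (-ρ) ρ, φ t) (𝓝[>] 0) (𝓝 0)) :
    Tendsto (fun a : ℝ => ∫ u, φ (a * u) * (1 + |u|) ^ (-δ)) (𝓝[>] 0) (𝓝 0) := by
  have hδ0 : 0 < δ := by linarith
  have hq : ∀ a : ℝ, 0 < a → Measure.QuasiMeasurePreserving (fun u : ℝ => a * u) volume volume :=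
    fun a ha => Measure.quasiMeasurePreserving_smul volume ha.ne'
  have hlayer : ∀ a : ℝ, 0 < a → _ := fun a ha =>
    integral_mul_rpow_eq hδ (φ := fun u => φ (a * u))
      (hφ.comp_quasiMeasurePreserving (hq a ha)) ((hq a ha).ae hM)
  -- Each layer is 2r times the mean of φ over [-ar, ar], so for fixed r it tends to 0 with a.
  have hscale : ∀ a : ℝ, 0 < a → ∀ r : ℝ, 0 < r → ∫ u in Ioo (-r) r, φ (a * u) =
      2 * r * ((2 * (a * r))⁻¹ * ∫ t in Icc (-(a * r)) (a * r), φ t) := fun a ha r hr => by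
    have har : 0 < a * r := mul_pos ha hr
    rw [← integral_Ioc_eq_integral_Ioo, ← intervalIntegral.integral_of_le (by linarith),
      intervalIntegral.integral_comp_mul_left _ ha.ne', mul_neg, integral_Icc_eq_integral_Ioc,
      ← intervalIntegral.integral_of_le (by linarith), smul_eq_mul]
    field_simp
  -- The layer integral is at most 2rM ≤ 2M(1 + r), which raises the exponent from -δ - 1 to -δ. The
  -- majorant is independent of a and integrable exactly because δ > 1.
  have hbound : ∀ a : ℝ, 0 < a → ∀ r : ℝ, 0 < r →
      ‖δ * (1 + r) ^ (-δ - 1) * ∫ u in Ioo (-r) r, φ (a * u)‖ ≤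
        2 * δ * M * (1 + ‖r‖) ^ (-δ) := fun a ha r hr => by
    have h1 : ‖∫ u in Ioo (-r) r, φ (a * u)‖ ≤ M * (2 * r) := by
      have := norm_setIntegral_le_of_norm_le_const_ae (μ := volume) (s := Ioo (-r) r)
        (f := fun u => φ (a * u)) (C := M) (by simp)
        (ae_restrict_of_ae ((hq a ha).ae hM))
      refine this.trans_eq ?_
      rw [Real.volume_real_Ioo_of_le (by linarith)]
      ring
    have hM0 : 0 ≤ M := by
      obtain ⟨u, hu⟩ := hM.exists
      exact (norm_nonneg _).trans hu
    have h2 : (1 + r) ^ (-δ) = (1 + r) ^ (-δ - 1) * (1 + r) := by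
      rw [Real.rpow_sub_one (by positivity)]
      field_simp
    rw [norm_mul, Real.norm_of_nonneg (by positivity), Real.norm_of_nonneg hr.le, h2]
    calc δ * (1 + r) ^ (-δ - 1) * ‖∫ u in Ioo (-r) r, φ (a * u)‖
        ≤ δ * (1 + r) ^ (-δ - 1) * (M * (2 * r)) := by gcongr
      _ ≤ δ * (1 + r) ^ (-δ - 1) * (M * (2 * (1 + r))) := by gcongr; linarith
      _ = _ := by ring
  have hlim : Tendsto (fun a : ℝ => ∫ r in Ioi 0, δ * (1 + r) ^ (-δ - 1) *
      ∫ u in Ioo (-r) r, φ (a * u)) (𝓝[>] 0) (𝓝 (∫ _ in Ioi (0 : ℝ), (0 : ℝ))) := by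
    refine tendsto_integral_filter_of_dominated_convergence
      (fun r => 2 * δ * M * (1 + ‖r‖) ^ (-δ)) ?_ ?_ ?_ ?_
    · filter_upwards [self_mem_nhdsWithin] with a ha
      exact (hlayer a ha).1.aestronglyMeasurable
    · filter_upwards [self_mem_nhdsWithin] with a ha
      filter_upwards [ae_restrict_mem measurableSet_Ioi] with r hr
      exact hbound a ha r hr
    · exact ((integrable_one_add_norm (by simpa using hδ)).const_mul _).restrict
    · filter_upwards [ae_restrict_mem measurableSet_Ioi] with r hr
      have hr' : (0 : ℝ) < r := hr
      have h1 : Tendsto (fun a : ℝ => a * r) (𝓝[>] 0) (𝓝[>] 0) := by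
        refine tendsto_nhdsWithin_iff.2 ⟨?_, ?_⟩
        · have : Continuous fun a : ℝ => a * r := by fun_prop
          exact (this.tendsto' 0 0 (by simp)).mono_left nhdsWithin_le_nhds
        · filter_upwards [self_mem_nhdsWithin] with a ha
          exact mul_pos ha hr'
      have h2 := ((hmean.comp h1).const_mul (2 * r)).const_mul (δ * (1 + r) ^ (-δ - 1))
      simp only [mul_zero] at h2
      refine h2.congr' ?_
      filter_upwards [self_mem_nhdsWithin] with a ha
      rw [hscale a ha r hr']
      rfl
  rw [integral_zero] at hlim
  refine hlim.congr' ?_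
  filter_upwards [self_mem_nhdsWithin] with a ha
  exact (hlayer a ha).2.symm

theorem tendsto_of_isLebesguePoint {f ψ : ℝ → ℂ} {I : ℝ → ℂ} {x c : ℝ}
    (hf : MemLp f ∞ volume) (hδ : 1 < δ) (hψ : ∀ u, ‖ψ u‖ ≤ c * (|u| + 1) ^ (-δ))
    (hI : ∀ a, 0 < a → I a - f x = ∫ u, (f (x - a * u) - f x) * ψ u)
    (hx : IsLebesguePoint f x) : Tendsto I (𝓝[>] (0 : ℝ)) (𝓝 (f x)) := by
  obtain ⟨M, -, hM⟩ := MemLp.exists_ae_norm_le hf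
  -- Reflection about x keeps [x - r, x + r] invariant, so the Lebesgue point condition says that
  -- the symmetric means of φ at 0 tend to 0. Taking absolute values leaves only the bound on |ψ| to
  -- be used.
  let φ : ℝ → ℝ := fun t => ‖f (x - t) - f x‖
  have hq : Measure.QuasiMeasurePreserving (fun t : ℝ => x - t) volume volume :=
    (Measure.measurePreserving_sub_left volume x).quasiMeasurePreserving
  have hφ : AEStronglyMeasurable φ volume :=
    ((hf.aestronglyMeasurable.comp_quasiMeasurePreserving hq).sub aestronglyMeasurable_const).norm
  have hφM : ∀ᵐ t, ‖φ t‖ ≤ M + ‖f x‖ := by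
    filter_upwards [hq.ae hM] with t ht
    rw [norm_norm]
    exact (norm_sub_le _ _).trans (by gcongr)
  have hmean : Tendsto (fun ρ : ℝ => (2 * ρ)⁻¹ * ∫ t in Icc (-ρ) ρ, φ t) (𝓝[>] 0) (𝓝 0) := by
    refine hx.congr' ?_
    filter_upwards [self_mem_nhdsWithin] with ρ hρ
    have hρ' : (0 : ℝ) < ρ := hρ
    congr 1
    rw [integral_Icc_eq_integral_Ioc, integral_Icc_eq_integral_Ioc,
      ← intervalIntegral.integral_of_le (by linarith),
      ← intervalIntegral.integral_of_le (by linarith),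
      intervalIntegral.integral_comp_sub_left (fun t => ‖f t - f x‖), sub_neg_eq_add]
  have hcore := (tendsto_integral_comp_mul_rpow hδ hφ hφM hmean).const_mul c
  rw [mul_zero] at hcore
  rw [tendsto_iff_norm_sub_tendsto_zero]
  refine squeeze_zero' (.of_forall fun _ => norm_nonneg _) ?_ hcore
  filter_upwards [self_mem_nhdsWithin] with a ha
  have ha' : (0 : ℝ) < a := ha
  rw [hI a ha, ← integral_const_mul]
  have hqa : Measure.QuasiMeasurePreserving (fun u : ℝ => a * u) volume volume :=
    Measure.quasiMeasurePreserving_smul volume ha'.ne'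
  have hint : Integrable fun u => c * (φ (a * u) * (1 + |u|) ^ (-δ)) :=
    ((integrable_one_add_norm (E := ℝ) (μ := volume) (by simpa using hδ)).bdd_mul
      (hφ.comp_quasiMeasurePreserving hqa) (hqa.ae hφM)).const_mul c
  refine norm_integral_le_of_norm_le hint (.of_forall fun u => ?_)
  rw [norm_mul]
  calc ‖f (x - a * u) - f x‖ * ‖ψ u‖ ≤ ‖f (x - a * u) - f x‖ * (c * (|u| + 1) ^ (-δ)) := by
        gcongr; exact hψ u
    _ = c * (φ (a * u) * (1 + |u|) ^ (-δ)) := by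
        rw [add_comm |u| 1]; ring

theorem ae_isLebesguePoint {f : ℝ → ℂ} (hf : LocallyIntegrable f) :
    ∀ᵐ x, IsLebesguePoint f x := by
  filter_upwards [IsUnifLocDoublingMeasure.ae_tendsto_average_norm_sub volume hf 1] with x hx
  -- Lebesgue differentiation along balls with fixed centre x and radius r tending to 0.
  have h1 := hx (l := 𝓝[>] (0 : ℝ)) (fun _ => x) id tendsto_id (by
    filter_upwards [self_mem_nhdsWithin] with r hr
    exact Metric.mem_closedBall_self (by simpa using le_of_lt hr))
  refine h1.congr' ?_
  filter_upwards [self_mem_nhdsWithin] with r hr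
  have hr' : (0 : ℝ) < r := hr
  rw [setAverage_eq, id, Real.closedBall_eq_Icc, Real.volume_real_Icc_of_le (by linarith),
    smul_eq_mul]
  congr 2
  ring

theorem ContinuousAt.isLebesguePoint {f : ℝ → ℂ} {x : ℝ} (hf : ContinuousAt f x) :
    IsLebesguePoint f x := by
  rw [IsLebesguePoint, Metric.tendsto_nhds]
  intro ε hε
  obtain ⟨η, hη, hfη⟩ := Metric.continuousAt_iff.1 hf (ε / 2) (half_pos hε)
  filter_upwards [Ioo_mem_nhdsGT hη] with r hr
  have h1 : ‖∫ t in Icc (x - r) (x + r), ‖f t - f x‖‖ ≤ ε / 2 * (2 * r) := by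
    have := norm_setIntegral_le_of_norm_le_const (μ := volume) (s := Icc (x - r) (x + r))
      (f := fun t => ‖f t - f x‖) (C := ε / 2) (by simp) (fun t ht => by
        rw [norm_norm, ← dist_eq_norm]
        refine (hfη ?_).le
        rw [Real.dist_eq, abs_lt]
        constructor <;> linarith [ht.1, ht.2, hr.2])
    refine this.trans_eq ?_
    rw [Real.volume_real_Icc_of_le (by linarith [hr.1])]
    ring
  have hr0 : 0 < 2 * r := by linarith [hr.1]
  rw [dist_zero_right, norm_mul, norm_inv, Real.norm_of_nonneg hr0.le, inv_mul_lt_iff₀ hr0]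
  nlinarith

end LebesguePoints

theorem mainTheorem5 (f ψ : ℝ → ℂ)
    (hf : MemLp f ∞ volume)
    (hψ : Integrable ψ volume) (hψ_one : ∫ t, ψ t = 1)
    (h_ac : IsAbsolutelyContinuous (fourierL1 ψ))
    (h_int : Integrable (fourierL1 ψ) volume)
    (h_deriv_int : Integrable (deriv (fourierL1 ψ)) volume)
    (h_deriv_bv : IsAEBoundedVariation (deriv (fourierL1 ψ))) :
    (∀ a : ℝ, 0 < a → ∀ x : ℝ, FourierIntegrableAgainst f (inversionKernel ψ a x)) ∧
    (UniformContinuous f →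
      TendstoUniformly (fun a x => inversionMean ψ f a x) f (𝓝[>] (0 : ℝ)) ∧
      Tendsto (fun a => eLpNorm (fun x => f x - inversionMean ψ f a x) ∞ volume)
        (𝓝[>] (0 : ℝ)) (𝓝 0)) ∧
    (∀ c δ : ℝ, 0 < c → 1 < δ → (∀ x, ‖ψ x‖ ≤ c * (|x| + 1) ^ (-δ)) →
      (∀ x, IsLebesguePoint f x →
        Tendsto (fun a => inversionMean ψ f a x) (𝓝[>] (0 : ℝ)) (𝓝 (f x))) ∧
      (∀ᵐ x ∂volume, Tendsto (fun a => inversionMean ψ f a x) (𝓝[>] (0 : ℝ)) (𝓝 (f x))) ∧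
      (∀ x, ContinuousAt f x →
        Tendsto (fun a => inversionMean ψ f a x) (𝓝[>] (0 : ℝ)) (𝓝 (f x)))) := by
  obtain ⟨h, H⟩ := h_ac.exists_isIntegrableBVPrimitive h_int h_deriv_int h_deriv_bv
  refine ⟨fun a ha x => ?_, fun huc => ?_, fun c δ _ hδ hψc => ?_⟩
  · obtain ⟨k, hk⟩ := isIntegrableBVPrimitive_inversionKernel H ha x
    exact hk.fourierIntegrableAgainst hf
  · have hunif : TendstoUniformly (fun a x => inversionMean ψ f a x) f (𝓝[>] (0 : ℝ)) :=
      tendstoUniformly_of_sub_eq_integral hf hψ huc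
        fun a ha x => inversionMean_sub_eq hf hψ hψ_one H ha x
    exact ⟨hunif, tendsto_eLpNorm_top_of_tendstoUniformly hunif⟩
  · have hleb : ∀ x, IsLebesguePoint f x →
        Tendsto (fun a => inversionMean ψ f a x) (𝓝[>] (0 : ℝ)) (𝓝 (f x)) := fun x hx =>
      tendsto_of_isLebesguePoint hf hδ hψc
        (fun a ha => inversionMean_sub_eq hf hψ hψ_one H ha x) hx
    refine ⟨hleb, ?_, fun x hx => hleb x hx.isLebesguePoint⟩
    filter_upwards [ae_isLebesguePoint (hf.locallyIntegrable le_top)] with x hx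
    exact hleb x hx
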